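/- Conventions. A locally compact Hausdorff groupoid $G$ has unit space $G^{(0)}$, range and source maps $r,s$, and product $\gamma\eta$ defined when $s(\gamma)=r(\eta)$. A $(G,H)$-equivalence is a second countable locally compact Hausdorff space $Z$ that is a free and proper left $G$-space and a free and proper right $H$-space (with continuous open surjective anchor maps $r_Z:Z\to G^{(0)}$ and $s_Z:Z\to H^{(0)}$), such that the two actions commute, $r_Z$ induces a homeomorphism $Z/H\cong G^{(0)}$, and $s_Z$ induces a homeomorphism $G\backslash Z\cong H^{(0)}$. Its linking groupoid is the topological disjoint union $L=G\sqcup Z\sqcup Z^{\mathrm{op}}\sqcup H$ over $L^{(0)}=G^{(0)}\sqcup H^{(0)}$, where $Z^{\mathrm{op}}=\{\bar z: z\in Z\}$ is a homeomorphic copy of $Z$ with $r(\bar z)=s_Z(z)$ and $s(\bar z)=r_Z(z)$. Its product is given by the products of $G$ and $H$, by the actions on $Z$, by $\bar z\,\gamma=\overline{\gamma^{-1}\cdot z}$ and $\eta\,\bar z=\overline{z\cdot\eta^{-1}}$, by $z\bar w=$ the unique $\gamma\in G$ with $\gamma\cdot w=z$, and by $\bar z w=$ the unique $\eta\in H$ with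 $z\cdot\eta=w$; its inversion is given by the inversions of $G$ and $H$ and $z^{-1}=\bar z$. An action of a groupoid $G$ on an upper semicontinuous $C^*$-bundle $\mathcal A\to G^{(0)}$ is a family of $*$-isomorphisms $\alpha_\gamma:\mathcal A_{s(\gamma)}\to\mathcal A_{r(\gamma)}$ with $\alpha_{\gamma\eta}=\alpha_\gamma\circ\alpha_\eta$ for composable $\gamma,\eta$, such that $(\gamma,a)\mapsto\alpha_\gamma(a)$ is continuous; then $(\mathcal A,G,\alpha)$ is called a groupoid dynamical system. Proposition. Let $G$ and $H$ be second countable locally compact Hausdorff groupoids, let $Z$ be a $(G,H)$-equivalence with linking groupoid $L$, and let $(\mathcal A,H,\alpha)$ be a groupoid dynamical system with bundle map $p:\mathcal A\to H^{(0)}$. Let $\mathcal A^Z$ be the quotient space of $s_Z^*\mathcal A=\{(z,a)\in Z\times\mathcal A: s_Z(z)=p(a)\}$ by the $H$-action $(z,a)\cdot\eta=(z\cdot\eta,\alpha_\eta^{-1}(a))$, let $p^Z:\mathcal A^Z\to G^{(0)}$ be the map $p^Z([z,a])=r_Z(z)$, and give each fibre $\mathcal A^Z_{u}$ the $C^*$-algebra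 structure for which $a\mapsto[z,a]$, $\mathcal A_{s_Z(z)}\to\mathcal A^Z_{u}$, is an isomorphism, where $r_Z(z)=u$. Let $\mathcal B=\mathcal A^Z\sqcup\mathcal A$ (topological disjoint union) with bundle map $q=p^Z\sqcup p:\mathcal B\to L^{(0)}$. Then $L$ is a second countable locally compact Hausdorff groupoid, $\mathcal B$ is an upper semicontinuous $C^*$-bundle over $L^{(0)}$, and there is a (continuous) action $\beta$ of $L$ on $\mathcal B$ by $*$-isomorphisms $\beta_k:\mathcal B_{s(k)}\to\mathcal B_{r(k)}$ such that: (a) for $\gamma\in G$, $\beta_\gamma=\alpha^Z_\gamma$, that is, $\beta_\gamma([z,a])=[\gamma\cdot z,a]$ whenever $s(\gamma)=r_Z(z)$; (b) for $\eta\in H$, $\beta_\eta=\alpha_\eta$; (c) for $z\in Z$, $\beta_z:\mathcal A_{s_Z(z)}\to\mathcal A^Z_{r_Z(z)}$ is given by $\beta_z(a)=[z,a]$; (d) for $\bar z\in Z^{\mathrm{op}}$, $\beta_{\bar z}=\beta_z^{-1}$, that is, $\beta_{\bar z}([z,a])=a$. Thus $(\mathcal B,L,\beta)$ is a groupoid dynamical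 system; its restriction to $H$ is $(\mathcal A,H,\alpha)$: the inclusion of $\mathcal A$ into $\mathcal B$ is a homeomorphism onto the open set $\mathcal B|_{H^{(0)}}$ and $\beta_\eta=\alpha_\eta$ for all $\eta\in H$. If moreover the section algebra $\Gamma_0(H^{(0)},\mathcal A)$ is separable, then so is $\Gamma_0(L^{(0)},\mathcal B)$, so that $(\mathcal B,L,\beta)$ is separable. -/

import Mathlib

open Topology Filter
open scoped MulOpposite

universe u uG uG0 uH uH0 uZ uX uA

noncomputable section

namespace GpdDyn

/-! ### Topological groupoids -/

/-- A groupoid with set of arrows `G` and set of units `G₀` (regarded as a subset of `G` through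
`unit`).  The product `mul x y` is defined exactly on the composable pairs, `s x = r y`. -/
structure Gpd (G : Type uG) (G₀ : Type uG0) where
  r : G → G₀
  s : G → G₀
  unit : G₀ → G
  mul : (x y : G) → s x = r y → G
  inv : G → G
  r_unit : ∀ u, r (unit u) = u
  s_unit : ∀ u, s (unit u) = u
  r_mul : ∀ x y h, r (mul x y h) = r x
  s_mul : ∀ x y h, s (mul x y h) = s y
  mul_assoc : ∀ x y z (h₁ : s x = r y) (h₂ : s y = r z),
    mul (mul x y h₁) z ((s_mul x y h₁).trans h₂) = mul x (mul y z h₂) (h₁.trans (r_mul y z h₂).symm)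
  unit_mul : ∀ x, mul (unit (r x)) x (s_unit (r x)) = x
  mul_unit : ∀ x, mul x (unit (s x)) (r_unit (s x)).symm = x
  r_inv : ∀ x, r (inv x) = s x
  s_inv : ∀ x, s (inv x) = r x
  inv_mul : ∀ x, mul (inv x) x (s_inv x) = unit (s x)
  mul_inv : ∀ x, mul x (inv x) (r_inv x).symm = unit (r x)

variable {G : Type uG} {G₀ : Type uG0} {H : Type uH} {H₀ : Type uH0}

/-- The set of composable pairs. -/
def Gpd.Composable (Γ : Gpd G G₀) : Type uG := {p : G × G // Γ.s p.1 = Γ.r p.2}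

instance (Γ : Gpd G G₀) [TopologicalSpace G] : TopologicalSpace Γ.Composable :=
  inferInstanceAs (TopologicalSpace {p : G × G // Γ.s p.1 = Γ.r p.2})

/-- `Γ` is a second countable locally compact Hausdorff groupoid.  Since `unit` is a continuous
section of the continuous map `r`, the topology of `G₀` is the subspace topology from `G`. -/
structure Gpd.IsLCH [TopologicalSpace G] [TopologicalSpace G₀] (Γ : Gpd G G₀) : Prop where
  locallyCompact : LocallyCompactSpace G
  hausdorff : T2Space G
  secondCountable : SecondCountableTopology G
  continuous_r : Continuous Γ.r
  continuous_s : Continuous Γ.s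
  continuous_unit : Continuous Γ.unit
  continuous_mul : Continuous fun p : Γ.Composable => Γ.mul p.1.1 p.1.2 p.2
  continuous_inv : Continuous Γ.inv

section algebra

variable (Γ : Gpd G G₀)

theorem Gpd.mul_congr {x x' y y' : G} (hx : x = x') (hy : y = y') (h : Γ.s x = Γ.r y)
    (h' : Γ.s x' = Γ.r y') : Γ.mul x y h = Γ.mul x' y' h' := by
  subst hx hy; rfl

end algebra

/-! ### Groupoid spaces -/

/-- A left `Γ`-space structure on `Z`. -/
structure LeftSpace [TopologicalSpace G] [TopologicalSpace G₀] (Γ : Gpd G G₀) (Z : Type uZ)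
    [TopologicalSpace Z] where
  anchor : Z → G₀
  smul : (γ : G) → (z : Z) → Γ.s γ = anchor z → Z
  anchor_smul : ∀ γ z h, anchor (smul γ z h) = Γ.r γ
  mul_smul : ∀ γ η z (h₁ : Γ.s γ = Γ.r η) (h₂ : Γ.s η = anchor z),
    smul (Γ.mul γ η h₁) z ((Γ.s_mul γ η h₁).trans h₂)
      = smul γ (smul η z h₂) (h₁.trans (anchor_smul η z h₂).symm)
  unit_smul : ∀ z, smul (Γ.unit (anchor z)) z (Γ.s_unit _) = z
  continuous_anchor : Continuous anchor
  isOpenMap_anchor : IsOpenMap anchor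
  surjective_anchor : Function.Surjective anchor
  continuous_smul : Continuous
    fun p : {p : G × Z // Γ.s p.1 = anchor p.2} => smul p.1.1 p.1.2 p.2

/-- A right `Δ`-space structure on `Z`. -/
structure RightSpace [TopologicalSpace H] [TopologicalSpace H₀] (Δ : Gpd H H₀) (Z : Type uZ)
    [TopologicalSpace Z] where
  anchor : Z → H₀
  smul : (z : Z) → (η : H) → anchor z = Δ.r η → Z
  anchor_smul : ∀ z η h, anchor (smul z η h) = Δ.s η
  smul_mul : ∀ z η θ (h₁ : anchor z = Δ.r η) (h₂ : Δ.s η = Δ.r θ),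
    smul z (Δ.mul η θ h₂) (h₁.trans (Δ.r_mul η θ h₂).symm)
      = smul (smul z η h₁) θ ((anchor_smul z η h₁).trans h₂)
  smul_unit : ∀ z, smul z (Δ.unit (anchor z)) (Δ.r_unit _).symm = z
  continuous_anchor : Continuous anchor
  isOpenMap_anchor : IsOpenMap anchor
  surjective_anchor : Function.Surjective anchor
  continuous_smul : Continuous
    fun p : {p : Z × H // anchor p.1 = Δ.r p.2} => smul p.1.1 p.1.2 p.2

section spaces

variable [TopologicalSpace G] [TopologicalSpace G₀] {Γ : Gpd G G₀}
  [TopologicalSpace H] [TopologicalSpace H₀] {Δ : Gpd H H₀} {Z : Type uZ} [TopologicalSpace Z]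

namespace LeftSpace

/-- Free and proper. -/
structure IsPrincipal (X : LeftSpace Γ Z) : Prop where
  free : ∀ γ z h, X.smul γ z h = z → γ ∈ Set.range Γ.unit
  proper : IsProperMap
    fun p : {p : G × Z // Γ.s p.1 = X.anchor p.2} => ((X.smul p.1.1 p.1.2 p.2, p.1.2) : Z × Z)

theorem smul_congr (X : LeftSpace Γ Z) {γ γ' : G} {z z' : Z} (hγ : γ = γ') (hz : z = z')
    (h : Γ.s γ = X.anchor z) (h' : Γ.s γ' = X.anchor z') : X.smul γ z h = X.smul γ' z' h' := by
  subst hγ hz; rfl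

theorem inv_smul_smul (X : LeftSpace Γ Z) (γ : G) (z : Z) (h : Γ.s γ = X.anchor z) :
    X.smul (Γ.inv γ) (X.smul γ z h) ((Γ.s_inv γ).trans (X.anchor_smul γ z h).symm) = z := by
  rw [← X.mul_smul (Γ.inv γ) γ z (Γ.s_inv γ) h]
  exact (X.smul_congr ((Γ.inv_mul γ).trans (congrArg _ h)) rfl _ (Γ.s_unit _)).trans (X.unit_smul z)

/-- The orbit equivalence relation, with quotient `G \ Z`. -/
def orbitSetoid (X : LeftSpace Γ Z) : Setoid Z where
  r z w := ∃ γ h, X.smul γ z h = w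
  iseqv :=
    { refl := fun z => ⟨_, _, X.unit_smul z⟩
      symm := by
        rintro z w ⟨γ, h, rfl⟩
        exact ⟨_, _, X.inv_smul_smul γ z h⟩
      trans := by
        rintro z w x ⟨γ, h, rfl⟩ ⟨η, h', rfl⟩
        exact ⟨_, _, X.mul_smul η γ z (h'.trans (X.anchor_smul γ z h)) h⟩ }

theorem eq_of_smul_eq (X : LeftSpace Γ Z) (hX : X.IsPrincipal) {γ γ' : G} {z : Z}
    (h : Γ.s γ = X.anchor z) (h' : Γ.s γ' = X.anchor z) (e : X.smul γ z h = X.smul γ' z h') :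
    γ = γ' := by
  have hr : Γ.r γ = Γ.r γ' := by rw [← X.anchor_smul γ z h, e, X.anchor_smul]
  have h1 : Γ.s (Γ.inv γ') = Γ.r γ := (Γ.s_inv γ').trans hr.symm
  have key : X.smul (Γ.mul (Γ.inv γ') γ h1) z ((Γ.s_mul _ _ h1).trans h) = z := by
    rw [X.mul_smul (Γ.inv γ') γ z h1 h]
    exact (X.smul_congr rfl e _ _).trans (X.inv_smul_smul γ' z h')
  obtain ⟨u, hu⟩ := hX.free _ _ _ key
  have hu2 : u = Γ.s γ := by rw [← Γ.s_unit u, hu, Γ.s_mul]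
  have h2 : Γ.s γ' = Γ.r (Γ.mul (Γ.inv γ') γ h1) := by rw [Γ.r_mul, Γ.r_inv]
  calc γ = Γ.mul (Γ.unit (Γ.r γ)) γ (Γ.s_unit _) := (Γ.unit_mul γ).symm
    _ = Γ.mul (Γ.mul γ' (Γ.inv γ') (Γ.r_inv γ').symm) γ ((Γ.s_mul _ _ _).trans h1) :=
        Γ.mul_congr ((congrArg _ hr).trans (Γ.mul_inv γ').symm) rfl _ _
    _ = Γ.mul γ' (Γ.mul (Γ.inv γ') γ h1) h2 := Γ.mul_assoc _ _ _ _ _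
    _ = Γ.mul γ' (Γ.unit (Γ.s γ')) (Γ.r_unit _).symm :=
        Γ.mul_congr rfl (by rw [← hu, hu2, h, h']) _ _
    _ = γ' := Γ.mul_unit γ'

end LeftSpace

namespace RightSpace

/-- Free and proper. -/
structure IsPrincipal (X : RightSpace Δ Z) : Prop where
  free : ∀ z η h, X.smul z η h = z → η ∈ Set.range Δ.unit
  proper : IsProperMap
    fun p : {p : Z × H // X.anchor p.1 = Δ.r p.2} => ((p.1.1, X.smul p.1.1 p.1.2 p.2) : Z × Z)

theorem smul_congr (X : RightSpace Δ Z) {η η' : H} {z z' : Z} (hz : z = z') (hη : η = η')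
    (h : X.anchor z = Δ.r η) (h' : X.anchor z' = Δ.r η') : X.smul z η h = X.smul z' η' h' := by
  subst hη hz; rfl

theorem smul_smul_inv (X : RightSpace Δ Z) (z : Z) (η : H) (h : X.anchor z = Δ.r η) :
    X.smul (X.smul z η h) (Δ.inv η) ((X.anchor_smul z η h).trans (Δ.r_inv η).symm) = z := by
  rw [← X.smul_mul z η (Δ.inv η) h (Δ.r_inv η).symm]
  exact (X.smul_congr rfl ((Δ.mul_inv η).trans (congrArg _ h.symm)) _ (Δ.r_unit _).symm).trans
    (X.smul_unit z)

/-- The orbit equivalence relation, with quotient `Z / H`. -/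
def orbitSetoid (X : RightSpace Δ Z) : Setoid Z where
  r z w := ∃ η h, X.smul z η h = w
  iseqv :=
    { refl := fun z => ⟨_, _, X.smul_unit z⟩
      symm := by
        rintro z w ⟨η, h, rfl⟩
        exact ⟨_, _, X.smul_smul_inv z η h⟩
      trans := by
        rintro z w x ⟨η, h, rfl⟩ ⟨θ, h', rfl⟩
        exact ⟨_, _, X.smul_mul z η θ h ((X.anchor_smul z η h).symm.trans h')⟩ }

theorem eq_of_smul_eq (X : RightSpace Δ Z) (hX : X.IsPrincipal) {η η' : H} {z : Z}
    (h : X.anchor z = Δ.r η) (h' : X.anchor z = Δ.r η') (e : X.smul z η h = X.smul z η' h') :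
    η = η' := by
  have hs : Δ.s η = Δ.s η' := by rw [← X.anchor_smul z η h, e, X.anchor_smul]
  have h1 : Δ.s η = Δ.r (Δ.inv η') := hs.trans (Δ.r_inv η').symm
  have key : X.smul z (Δ.mul η (Δ.inv η') h1) (h.trans (Δ.r_mul _ _ h1).symm) = z := by
    rw [X.smul_mul z η (Δ.inv η') h h1]
    exact (X.smul_congr e rfl _ _).trans (X.smul_smul_inv z η' h')
  obtain ⟨u, hu⟩ := hX.free _ _ _ key
  have hu2 : u = Δ.r η := by rw [← Δ.r_unit u, hu, Δ.r_mul]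
  have h2 : Δ.s (Δ.mul η (Δ.inv η') h1) = Δ.r η' := by rw [Δ.s_mul, Δ.s_inv]
  calc η = Δ.mul η (Δ.unit (Δ.s η)) (Δ.r_unit _).symm := (Δ.mul_unit η).symm
    _ = Δ.mul η (Δ.mul (Δ.inv η') η' (Δ.s_inv η')) (h1.trans (Δ.r_mul _ _ _).symm) :=
        Δ.mul_congr rfl ((congrArg _ hs).trans (Δ.inv_mul η').symm) _ _
    _ = Δ.mul (Δ.mul η (Δ.inv η') h1) η' h2 := (Δ.mul_assoc _ _ _ _ _).symm
    _ = Δ.mul (Δ.unit (Δ.r η')) η' (Δ.s_unit _) :=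
        Δ.mul_congr (by rw [← hu, hu2, ← h, ← h']) rfl _ _
    _ = η' := Δ.unit_mul η'

end RightSpace

variable (Γ Δ Z) in
/-- A `(G, H)`-equivalence structure on the space `Z`; `left.anchor` is the range map `r_Z` and
`right.anchor` is the source map `s_Z`. -/
structure GpdEquivalence where
  left : LeftSpace Γ Z
  right : RightSpace Δ Z
  left_principal : left.IsPrincipal
  right_principal : right.IsPrincipal
  left_anchor_smul : ∀ z η h, left.anchor (right.smul z η h) = left.anchor z
  right_anchor_smul : ∀ γ z h, right.anchor (left.smul γ z h) = right.anchor z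
  smul_comm : ∀ γ z η (h₁ : Γ.s γ = left.anchor z) (h₂ : right.anchor z = Δ.r η),
    right.smul (left.smul γ z h₁) η ((right_anchor_smul γ z h₁).trans h₂)
      = left.smul γ (right.smul z η h₂) (h₁.trans (left_anchor_smul z η h₂).symm)
  left_anchor_homeo : IsHomeomorph (Quotient.lift left.anchor
    (fun z _ ⟨η, h, e⟩ => (left_anchor_smul z η h).symm.trans (congrArg left.anchor e)) :
      Quotient right.orbitSetoid → G₀)
  right_anchor_homeo : IsHomeomorph (Quotient.lift right.anchor
    (fun z _ ⟨γ, h, e⟩ => (right_anchor_smul γ z h).symm.trans (congrArg right.anchor e)) :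
      Quotient left.orbitSetoid → H₀)

namespace GpdEquivalence

variable (E : GpdEquivalence Γ Δ Z)

theorem exists_left (z w : Z) (h : E.right.anchor z = E.right.anchor w) :
    ∃ γ h, E.left.smul γ w h = z :=
  Quotient.exact (s := E.left.orbitSetoid)
    (E.right_anchor_homeo.bijective.1
      (a₁ := Quotient.mk E.left.orbitSetoid w) (a₂ := Quotient.mk E.left.orbitSetoid z) h.symm)

theorem exists_right (z w : Z) (h : E.left.anchor z = E.left.anchor w) :
    ∃ η h, E.right.smul z η h = w :=
  Quotient.exact (s := E.right.orbitSetoid)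
    (E.left_anchor_homeo.bijective.1
      (a₁ := Quotient.mk E.right.orbitSetoid z) (a₂ := Quotient.mk E.right.orbitSetoid w) h)

/-- The arrow `_G[z, w]`: the unique `γ` with `γ • w = z`. -/
def lbr (z w : Z) (h : E.right.anchor z = E.right.anchor w) : G := (E.exists_left z w h).choose

/-- The arrow `[z, w]_H`: the unique `η` with `z • η = w`. -/
def rbr (z w : Z) (h : E.left.anchor z = E.left.anchor w) : H := (E.exists_right z w h).choose

theorem s_lbr (z w : Z) (h) : Γ.s (E.lbr z w h) = E.left.anchor w :=
  (E.exists_left z w h).choose_spec.choose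

theorem lbr_smul (z w : Z) (h) : E.left.smul (E.lbr z w h) w (E.s_lbr z w h) = z :=
  (E.exists_left z w h).choose_spec.choose_spec

theorem r_lbr (z w : Z) (h) : Γ.r (E.lbr z w h) = E.left.anchor z := by
  rw [← E.left.anchor_smul _ w (E.s_lbr z w h), E.lbr_smul]

theorem r_rbr (z w : Z) (h) : E.right.anchor z = Δ.r (E.rbr z w h) :=
  (E.exists_right z w h).choose_spec.choose

theorem smul_rbr (z w : Z) (h) : E.right.smul z (E.rbr z w h) (E.r_rbr z w h) = w :=
  (E.exists_right z w h).choose_spec.choose_spec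

theorem s_rbr (z w : Z) (h) : Δ.s (E.rbr z w h) = E.right.anchor w := by
  rw [← E.right.anchor_smul z _ (E.r_rbr z w h), E.smul_rbr]

theorem eq_lbr {z w : Z} (h) {γ : G} (hγ : Γ.s γ = E.left.anchor w)
    (e : E.left.smul γ w hγ = z) : γ = E.lbr z w h :=
  E.left.eq_of_smul_eq E.left_principal hγ (E.s_lbr z w h) (e.trans (E.lbr_smul z w h).symm)

theorem eq_rbr {z w : Z} (h) {η : H} (hη : E.right.anchor z = Δ.r η)
    (e : E.right.smul z η hη = w) : η = E.rbr z w h :=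
  E.right.eq_of_smul_eq E.right_principal hη (E.r_rbr z w h) (e.trans (E.smul_rbr z w h).symm)

theorem left_cancel {γ : G} {z w : Z} (hz : Γ.s γ = E.left.anchor z)
    (hw : Γ.s γ = E.left.anchor w) (e : E.left.smul γ z hz = E.left.smul γ w hw) : z = w := by
  rw [← E.left.inv_smul_smul γ z hz, ← E.left.inv_smul_smul γ w hw]
  exact E.left.smul_congr rfl e _ _

theorem right_cancel {η : H} {z w : Z} (hz : E.right.anchor z = Δ.r η)
    (hw : E.right.anchor w = Δ.r η) (e : E.right.smul z η hz = E.right.smul w η hw) : z = w := by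
  rw [← E.right.smul_smul_inv z η hz, ← E.right.smul_smul_inv w η hw]
  exact E.right.smul_congr e rfl _ _

theorem smul_inv_smul (γ : G) (z : Z) (h : Γ.s (Γ.inv γ) = E.left.anchor z)
    (h' : Γ.s γ = E.left.anchor (E.left.smul (Γ.inv γ) z h)) :
    E.left.smul γ (E.left.smul (Γ.inv γ) z h) h' = z := by
  rw [← E.left.mul_smul γ (Γ.inv γ) z (Γ.r_inv γ).symm h]
  exact (E.left.smul_congr ((Γ.mul_inv γ).trans (congrArg _ ((Γ.s_inv γ).symm.trans h))) rfl _
    (Γ.s_unit _)).trans (E.left.unit_smul z)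

theorem smul_smul_inv' (η : H) (z : Z) (h : E.right.anchor z = Δ.r (Δ.inv η))
    (h' : E.right.anchor (E.right.smul z (Δ.inv η) h) = Δ.r η) :
    E.right.smul (E.right.smul z (Δ.inv η) h) η h' = z := by
  rw [← E.right.smul_mul z (Δ.inv η) η h (Δ.s_inv η)]
  exact (E.right.smul_congr rfl ((Δ.inv_mul η).trans (congrArg _ ((Δ.r_inv η).symm.trans h.symm)))
    _ (Δ.r_unit _).symm).trans (E.right.smul_unit z)

end GpdEquivalence

end spaces

/-! ### The linking groupoid -/

/-- The topological disjoint union `G ⊔ Z ⊔ Zᵒᵖ ⊔ H`, where the opposite space `Zᵒᵖ = {z̄ : z ∈ Z}`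
is the homeomorphic copy `Zᵐᵒᵖ` of `Z`, with `z̄ = MulOpposite.op z`. -/
abbrev Link (G : Type uG) (Z : Type uZ) (H : Type uH) : Type (max uG uZ uH) := G ⊕ Z ⊕ Zᵐᵒᵖ ⊕ H

namespace Link

variable {Z : Type uZ}

/-- The inclusion of `G`. -/
abbrev ofG (γ : G) : Link G Z H := .inl γ
/-- The inclusion of `Z`. -/
abbrev ofZ (z : Z) : Link G Z H := .inr (.inl z)
/-- The map `z ↦ z̄`. -/
abbrev ofZop (z : Z) : Link G Z H := .inr (.inr (.inl (MulOpposite.op z)))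
/-- The inclusion of `H`. -/
abbrev ofH (η : H) : Link G Z H := .inr (.inr (.inr η))

end Link

section linking

variable [TopologicalSpace G] [TopologicalSpace G₀] {Γ : Gpd G G₀}
  [TopologicalSpace H] [TopologicalSpace H₀] {Δ : Gpd H H₀} {Z : Type uZ} [TopologicalSpace Z]

namespace GpdEquivalence

variable (E : GpdEquivalence Γ Δ Z)

/-- The range map of the linking groupoid. -/
def linkR : Link G Z H → G₀ ⊕ H₀
  | .inl γ => .inl (Γ.r γ)
  | .inr (.inl z) => .inl (E.left.anchor z)
  | .inr (.inr (.inl z)) => .inr (E.right.anchor z.unop)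
  | .inr (.inr (.inr η)) => .inr (Δ.r η)

/-- The source map of the linking groupoid. -/
def linkS : Link G Z H → G₀ ⊕ H₀
  | .inl γ => .inl (Γ.s γ)
  | .inr (.inl z) => .inr (E.right.anchor z)
  | .inr (.inr (.inl z)) => .inl (E.left.anchor z.unop)
  | .inr (.inr (.inr η)) => .inr (Δ.s η)

/-- The multiplication of the linking groupoid; on `Zᵒᵖ` the actions are `η • z̄ = (z • η⁻¹)¯` and
`z̄ • γ = (γ⁻¹ • z)¯`. -/
def linkMul : (x y : Link G Z H) → E.linkS x = E.linkR y → Link G Z H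
  | .inl γ, .inl γ', h => .ofG (Γ.mul γ γ' (Sum.inl.inj h))
  | .inl γ, .inr (.inl z), h => .ofZ (E.left.smul γ z (Sum.inl.inj h))
  | .inl _, .inr (.inr (.inl _)), h => (Sum.inl_ne_inr h).elim
  | .inl _, .inr (.inr (.inr _)), h => (Sum.inl_ne_inr h).elim
  | .inr (.inl _), .inl _, h => (Sum.inr_ne_inl h).elim
  | .inr (.inl _), .inr (.inl _), h => (Sum.inr_ne_inl h).elim
  | .inr (.inl z), .inr (.inr (.inl w)), h => .ofG (E.lbr z w.unop (Sum.inr.inj h))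
  | .inr (.inl z), .inr (.inr (.inr η)), h => .ofZ (E.right.smul z η (Sum.inr.inj h))
  | .inr (.inr (.inl z)), .inl γ, h =>
      .ofZop (E.left.smul (Γ.inv γ) z.unop ((Γ.s_inv γ).trans (Sum.inl.inj h).symm))
  | .inr (.inr (.inl z)), .inr (.inl w), h => .ofH (E.rbr z.unop w (Sum.inl.inj h))
  | .inr (.inr (.inl _)), .inr (.inr (.inl _)), h => (Sum.inl_ne_inr h).elim
  | .inr (.inr (.inl _)), .inr (.inr (.inr _)), h => (Sum.inl_ne_inr h).elim
  | .inr (.inr (.inr _)), .inl _, h => (Sum.inr_ne_inl h).elim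
  | .inr (.inr (.inr _)), .inr (.inl _), h => (Sum.inr_ne_inl h).elim
  | .inr (.inr (.inr η)), .inr (.inr (.inl z)), h =>
      .ofZop (E.right.smul z.unop (Δ.inv η) ((Sum.inr.inj h).symm.trans (Δ.r_inv η).symm))
  | .inr (.inr (.inr η)), .inr (.inr (.inr η')), h => .ofH (Δ.mul η η' (Sum.inr.inj h))

/-- The inversion of the linking groupoid. -/
def linkInv (_E : GpdEquivalence Γ Δ Z) : Link G Z H → Link G Z H
  | .inl γ => .ofG (Γ.inv γ)
  | .inr (.inl z) => .ofZop z
  | .inr (.inr (.inl z)) => .ofZ z.unop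
  | .inr (.inr (.inr η)) => .ofH (Δ.inv η)

/-- The units of the linking groupoid. -/
def linkUnit (_E : GpdEquivalence Γ Δ Z) : G₀ ⊕ H₀ → Link G Z H
  | .inl u => .ofG (Γ.unit u)
  | .inr v => .ofH (Δ.unit v)

theorem linkR_mul (x y : Link G Z H) (h) : E.linkR (E.linkMul x y h) = E.linkR x := by
  rcases x with γ | z | z | η <;> rcases y with γ' | w | w | η' <;>
    first
    | exact (Sum.inl_ne_inr h).elim
    | exact (Sum.inr_ne_inl h).elim
    | skip
  · exact congrArg Sum.inl (Γ.r_mul _ _ _)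
  · exact congrArg Sum.inl (E.left.anchor_smul _ _ _)
  · exact congrArg Sum.inl (E.r_lbr _ _ _)
  · exact congrArg Sum.inl (E.left_anchor_smul _ _ _)
  · exact congrArg Sum.inr (E.right_anchor_smul _ _ _)
  · exact congrArg Sum.inr (E.r_rbr _ _ _).symm
  · exact congrArg Sum.inr ((E.right.anchor_smul _ _ _).trans (Δ.s_inv _))
  · exact congrArg Sum.inr (Δ.r_mul _ _ _)

theorem linkS_mul (x y : Link G Z H) (h) : E.linkS (E.linkMul x y h) = E.linkS y := by
  rcases x with γ | z | z | η <;> rcases y with γ' | w | w | η' <;>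
    first
    | exact (Sum.inl_ne_inr h).elim
    | exact (Sum.inr_ne_inl h).elim
    | skip
  · exact congrArg Sum.inl (Γ.s_mul _ _ _)
  · exact congrArg Sum.inr (E.right_anchor_smul _ _ _)
  · exact congrArg Sum.inl (E.s_lbr _ _ _)
  · exact congrArg Sum.inr (E.right.anchor_smul _ _ _)
  · exact congrArg Sum.inl ((E.left.anchor_smul _ _ _).trans (Γ.r_inv _))
  · exact congrArg Sum.inr (E.s_rbr _ _ _)
  · exact congrArg Sum.inl (E.left_anchor_smul _ _ _)
  · exact congrArg Sum.inr (Δ.s_mul _ _ _)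

theorem linkMul_assoc (x y z : Link G Z H) (h₁ : E.linkS x = E.linkR y)
    (h₂ : E.linkS y = E.linkR z) (h₃ h₄) :
    E.linkMul (E.linkMul x y h₁) z h₃ = E.linkMul x (E.linkMul y z h₂) h₄ := by
  rcases x with γ | x | x | η <;> rcases y with γ' | y | y | η' <;>
    first
    | exact (Sum.inl_ne_inr h₁).elim
    | exact (Sum.inr_ne_inl h₁).elim
    | skip
  all_goals
    rcases z with γ'' | z | z | η'' <;>
    first
    | exact (Sum.inl_ne_inr h₂).elim
    | exact (Sum.inr_ne_inl h₂).elim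
    | skip
  all_goals
    first
    | replace h₁ := Sum.inl.inj h₁
    | replace h₁ := Sum.inr.inj h₁
  all_goals
    first
    | replace h₂ := Sum.inl.inj h₂
    | replace h₂ := Sum.inr.inj h₂
  · exact congrArg Link.ofG (Γ.mul_assoc _ _ _ h₁ h₂)
  · exact congrArg Link.ofZ (E.left.mul_smul _ _ _ h₁ h₂)
  · refine congrArg Link.ofG (E.eq_lbr _ ((Γ.s_mul _ _ _).trans (E.s_lbr _ _ h₂)) ?_).symm
    rw [E.left.mul_smul _ _ _ (h₁.trans (E.r_lbr _ _ h₂).symm) (E.s_lbr _ _ h₂)]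
    exact E.left.smul_congr rfl (E.lbr_smul _ _ h₂) _ _
  · exact congrArg Link.ofZ (E.smul_comm _ _ _ h₁ h₂)
  · refine congrArg Link.ofG (E.eq_lbr _ ((Γ.s_mul _ _ _).trans ?_) ?_)
    · exact ((E.left.anchor_smul _ _ _).trans (Γ.r_inv _)).symm
    · refine (E.left.mul_smul _ _ _ ((E.s_lbr _ _ h₁).trans h₂)
        ((E.left.anchor_smul _ _ _).trans (Γ.r_inv _)).symm).trans ?_
      exact (E.left.smul_congr rfl (E.smul_inv_smul _ _ _ _) _ _).trans (E.lbr_smul _ _ h₁)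
  · refine congrArg Link.ofZ ?_
    refine (E.left.smul_congr rfl (E.smul_rbr _ _ h₂).symm _
      ((E.s_lbr _ _ h₁).trans (E.left_anchor_smul _ _ _).symm)).trans ?_
    rw [← E.smul_comm _ _ _ (E.s_lbr _ _ h₁) (E.r_rbr _ _ h₂)]
    exact E.right.smul_congr (E.lbr_smul _ _ h₁) rfl _ _
  · refine congrArg Link.ofG (E.eq_lbr _ ((E.s_lbr _ _ _).trans
      (E.left_anchor_smul _ _ _).symm) ?_)
    refine E.right_cancel (η := η') ?_ h₁ ?_
    · exact (E.right_anchor_smul _ _ _).trans ((E.right.anchor_smul _ _ _).trans (Δ.s_inv _))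
    · refine (E.smul_comm _ _ _ ((E.s_lbr _ _ _).trans (E.left_anchor_smul _ _ _).symm)
        ((E.right.anchor_smul _ _ _).trans (Δ.s_inv _))).trans ?_
      exact (E.left.smul_congr rfl (E.smul_smul_inv' _ _ _ _) _ (E.s_lbr _ _ _)).trans
        (E.lbr_smul _ _ _)
  · exact congrArg Link.ofZ (E.right.smul_mul _ _ _ h₁ h₂).symm
  · refine congrArg Link.ofZop ?_
    refine E.left_cancel (γ := Γ.mul γ' γ'' h₂) ?_ ?_ ?_
    · exact (Γ.s_mul _ _ _).trans ((E.left.anchor_smul _ _ _).trans (Γ.r_inv _)).symm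
    · exact ((E.left.anchor_smul _ _ _).trans (Γ.r_inv _)).symm
    · rw [E.smul_inv_smul, E.left.mul_smul _ _ _ h₂
        ((E.left.anchor_smul _ _ _).trans (Γ.r_inv _)).symm]
      exact (E.left.smul_congr rfl (E.smul_inv_smul _ _ _ _) _
        ((E.left.anchor_smul _ _ _).trans (Γ.r_inv _)).symm).trans (E.smul_inv_smul _ _ _ _)
  · refine congrArg Link.ofH (E.eq_rbr _ ((E.right_anchor_smul _ _ _).symm.trans
      (E.r_rbr _ _ _)) ?_)
    refine E.left_cancel (γ := Γ.inv γ') ((Γ.s_inv _).trans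
      (h₁.symm.trans (E.left_anchor_smul _ _ _).symm))
      ((Γ.s_inv _).trans (E.left.anchor_smul _ _ h₂).symm) ?_
    refine (E.smul_comm _ _ _ ((Γ.s_inv _).trans h₁.symm)
      ((E.right_anchor_smul _ _ _).symm.trans (E.r_rbr _ _ _))).symm.trans ?_
    exact (E.smul_rbr _ _ _).trans (E.left.inv_smul_smul _ _ _).symm
  · refine congrArg Link.ofZop ?_
    have a1 : Γ.s (E.lbr y z.unop h₂) = E.left.anchor
        (E.right.smul z.unop (Δ.inv (E.rbr x.unop y h₁))
          (h₂.symm.trans ((E.s_rbr _ _ h₁).symm.trans (Δ.r_inv _).symm))) :=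
      (E.s_lbr _ _ h₂).trans (E.left_anchor_smul _ _ _).symm
    refine E.left_cancel (γ := E.lbr y z.unop h₂) a1
      ((Γ.r_inv _).symm.trans (E.left.anchor_smul _ _ _).symm) ?_
    rw [E.smul_inv_smul, ← E.smul_comm _ _ _ (E.s_lbr _ _ h₂)
      (h₂.symm.trans ((E.s_rbr _ _ h₁).symm.trans (Δ.r_inv _).symm))]
    refine E.right_cancel (η := E.rbr x.unop y h₁)
      ((E.right.anchor_smul _ _ _).trans (Δ.s_inv _)) (E.r_rbr _ _ _) ?_
    rw [E.smul_smul_inv', E.smul_rbr, E.lbr_smul]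
  · refine congrArg Link.ofH (E.eq_rbr _ ((E.r_rbr _ _ h₁).trans (Δ.r_mul _ _ _).symm) ?_)
    rw [E.right.smul_mul _ _ _ (E.r_rbr _ _ h₁) ((E.s_rbr _ _ h₁).trans h₂)]
    exact E.right.smul_congr (E.smul_rbr _ _ h₁) rfl _ _
  · exact congrArg Link.ofZop (E.smul_comm _ _ _ ((Γ.s_inv _).trans h₂.symm)
      (h₁.symm.trans (Δ.r_inv _).symm)).symm
  · refine congrArg Link.ofH (E.eq_rbr _ ?_ ?_).symm
    · exact (E.right.anchor_smul _ _ _).trans ((Δ.s_inv _).trans (Δ.r_mul _ _ _).symm)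
    · refine (E.right.smul_mul _ _ _ ((E.right.anchor_smul _ _ _).trans (Δ.s_inv _))
        (h₁.trans (E.r_rbr _ _ h₂))).trans ?_
      exact (E.right.smul_congr (E.smul_smul_inv' _ _ _ _) rfl _ (E.r_rbr _ _ h₂)).trans
        (E.smul_rbr _ _ h₂)
  · refine congrArg Link.ofZop ?_
    refine E.right_cancel (η := Δ.mul η η' h₁) ?_ ?_ ?_
    · exact (E.right.anchor_smul _ _ _).trans (Δ.s_inv _)
    · exact (E.right.anchor_smul _ _ _).trans ((Δ.s_inv _).trans (Δ.r_mul _ _ _).symm)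
    · rw [E.smul_smul_inv', E.right.smul_mul _ _ _
        ((E.right.anchor_smul _ _ _).trans (Δ.s_inv _)) h₁]
      exact ((E.right.smul_congr (E.smul_smul_inv' _ _ _ _) rfl _
        ((E.right.anchor_smul _ _ _).trans (Δ.s_inv _))).trans (E.smul_smul_inv' _ _ _ _)).symm
  · exact congrArg Link.ofH (Δ.mul_assoc _ _ _ h₁ h₂)

/-- The linking groupoid of a `(G, H)`-equivalence. -/
def linking : Gpd (Link G Z H) (G₀ ⊕ H₀) where
  r := E.linkR
  s := E.linkS
  unit := E.linkUnit
  mul := E.linkMul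
  inv := E.linkInv
  r_unit := by
    rintro (u | v)
    · exact congrArg Sum.inl (Γ.r_unit u)
    · exact congrArg Sum.inr (Δ.r_unit v)
  s_unit := by
    rintro (u | v)
    · exact congrArg Sum.inl (Γ.s_unit u)
    · exact congrArg Sum.inr (Δ.s_unit v)
  r_mul := E.linkR_mul
  s_mul := E.linkS_mul
  mul_assoc := fun x y z h₁ h₂ => E.linkMul_assoc x y z h₁ h₂ _ _
  unit_mul := by
    rintro (γ | z | z | η)
    · exact congrArg Link.ofG (Γ.unit_mul γ)
    · exact congrArg Link.ofZ (E.left.unit_smul z)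
    · refine congrArg Link.ofZop (E.right_cancel (η := Δ.unit (E.right.anchor z.unop)) ?_ ?_ ?_)
      · exact (E.right.anchor_smul _ _ _).trans (Δ.s_inv _)
      · exact (Δ.r_unit _).symm
      · rw [E.smul_smul_inv']
        exact (E.right.smul_unit _).symm
    · exact congrArg Link.ofH (Δ.unit_mul η)
  mul_unit := by
    rintro (γ | z | z | η)
    · exact congrArg Link.ofG (Γ.mul_unit γ)
    · exact congrArg Link.ofZ (E.right.smul_unit z)
    · refine congrArg Link.ofZop (E.left_cancel (γ := Γ.unit (E.left.anchor z.unop)) ?_ ?_ ?_)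
      · exact ((E.left.anchor_smul _ _ _).trans (Γ.r_inv _)).symm
      · exact Γ.s_unit _
      · rw [E.smul_inv_smul]
        exact (E.left.unit_smul _).symm
    · exact congrArg Link.ofH (Δ.mul_unit η)
  r_inv := by
    rintro (γ | z | z | η)
    · exact congrArg Sum.inl (Γ.r_inv γ)
    · rfl
    · rfl
    · exact congrArg Sum.inr (Δ.r_inv η)
  s_inv := by
    rintro (γ | z | z | η)
    · exact congrArg Sum.inl (Γ.s_inv γ)
    · rfl
    · rfl
    · exact congrArg Sum.inr (Δ.s_inv η)
  inv_mul := by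
    rintro (γ | z | z | η)
    · exact congrArg Link.ofG (Γ.inv_mul γ)
    · exact congrArg Link.ofH (E.eq_rbr _ (Δ.r_unit _).symm (E.right.smul_unit z)).symm
    · exact congrArg Link.ofG (E.eq_lbr _ (Γ.s_unit _) (E.left.unit_smul _)).symm
    · exact congrArg Link.ofH (Δ.inv_mul η)
  mul_inv := by
    rintro (γ | z | z | η)
    · exact congrArg Link.ofG (Γ.mul_inv γ)
    · exact congrArg Link.ofG (E.eq_lbr _ (Γ.s_unit _) (E.left.unit_smul _)).symm
    · exact congrArg Link.ofH (E.eq_rbr _ (Δ.r_unit _).symm (E.right.smul_unit _)).symm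
    · exact congrArg Link.ofH (Δ.mul_inv η)

end GpdEquivalence

end linking

/-! ### Upper semicontinuous C⋆-bundles -/

/-- The total space of a family `A` of sets over `X`.  The topology on it is always given separately
(it is part of the structure of a bundle). -/
abbrev Tot {X : Type uX} (A : X → Type uA) : Type (max uX uA) := Bundle.TotalSpace Unit A

section bundles

variable {X : Type uX} {A : X → Type uA}

/-- A point of the total space, viewed as an element of a given fibre. -/
def toFiber (a : Tot A) {x : X} (h : a.proj = x) : A x := h ▸ a.2

variable (A) in
/-- `A` is an upper semicontinuous C⋆-bundle over `X`.  (The projection is automatically onto, since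
each fibre contains a zero.)  In `zero_nhds`, the points `a` with `a.proj` near `x` and small norm
are near the zero `0_x`; in terms of nets: if `a_i.proj → x` and `‖a_i‖ → 0`, then `a_i → 0_x`. -/
structure IsUSCCStarBundle [TopologicalSpace X] [∀ x, NonUnitalCStarAlgebra (A x)]
    [TopologicalSpace (Tot A)] : Prop where
  continuous_proj : Continuous fun a : Tot A => a.proj
  isOpenMap_proj : IsOpenMap fun a : Tot A => a.proj
  usc_norm : UpperSemicontinuous fun a : Tot A => ‖a.2‖
  continuous_add : Continuous fun p : {p : Tot A × Tot A // p.2.proj = p.1.proj} =>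
    (⟨p.1.1.proj, p.1.1.2 + toFiber p.1.2 p.2⟩ : Tot A)
  continuous_smul : ∀ c : ℂ, Continuous fun a : Tot A => (⟨a.proj, c • a.2⟩ : Tot A)
  continuous_mul : Continuous fun p : {p : Tot A × Tot A // p.2.proj = p.1.proj} =>
    (⟨p.1.1.proj, p.1.1.2 * toFiber p.1.2 p.2⟩ : Tot A)
  continuous_star : Continuous fun a : Tot A => (⟨a.proj, star a.2⟩ : Tot A)
  zero_nhds : ∀ x : X,
    comap (fun a : Tot A => (a.proj, ‖a.2‖)) (𝓝 (x, (0 : ℝ))) ≤ 𝓝 (⟨x, 0⟩ : Tot A)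

variable (A) in
/-- The continuous sections of `A` that vanish at infinity, i.e. the elements of the C⋆-algebra
`Γ₀(X, A)`. -/
structure C0Section [TopologicalSpace X] [∀ x, NonUnitalCStarAlgebra (A x)]
    [TopologicalSpace (Tot A)] where
  toFun : ∀ x, A x
  continuous_toFun : Continuous fun x => (⟨x, toFun x⟩ : Tot A)
  vanishes : Tendsto (fun x => ‖toFun x‖) (cocompact X) (𝓝 0)

variable (A) in
/-- The C⋆-algebra `Γ₀(X, A)` is separable in the supremum norm. -/
def HasSeparableSections [TopologicalSpace X] [∀ x, NonUnitalCStarAlgebra (A x)]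
    [TopologicalSpace (Tot A)] : Prop :=
  ∃ S : Set (C0Section A), S.Countable ∧
    ∀ f : C0Section A, ∀ ε : ℝ, 0 < ε → ∃ g ∈ S, ∀ x, ‖f.toFun x - g.toFun x‖ ≤ ε

end bundles

/-! ### Groupoid dynamical systems -/

section actions

variable {A : G₀ → Type uA} [∀ u, NonUnitalCStarAlgebra (A u)]

/-- The map `(γ, a) ↦ γ • a = α_γ(a)` of a family of isomorphisms `α_γ : A_{s γ} → A_{r γ}`. -/
def famAct (Γ : Gpd G G₀) (α : ∀ γ, A (Γ.s γ) ≃⋆ₐ[ℂ] A (Γ.r γ)) (γ : G) (a : Tot A)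
    (h : a.proj = Γ.s γ) : Tot A :=
  ⟨Γ.r γ, α γ (toFiber a h)⟩

/-- A (continuous) action of a groupoid on a C⋆-bundle over its unit space. -/
structure BundleAction [TopologicalSpace G] (Γ : Gpd G G₀) (A : G₀ → Type uA)
    [∀ u, NonUnitalCStarAlgebra (A u)] [TopologicalSpace (Tot A)] where
  iso : ∀ γ, A (Γ.s γ) ≃⋆ₐ[ℂ] A (Γ.r γ)
  mul_act : ∀ γ η (h : Γ.s γ = Γ.r η) (a : Tot A) (ha : a.proj = Γ.s η),
    famAct Γ iso (Γ.mul γ η h) a (ha.trans (Γ.s_mul γ η h).symm)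
      = famAct Γ iso γ (famAct Γ iso η a ha) h.symm
  continuous_act : Continuous
    fun p : {p : G × Tot A // p.2.proj = Γ.s p.1} => famAct Γ iso p.1.1 p.1.2 p.2

namespace BundleAction

variable [TopologicalSpace G] {Γ : Gpd G G₀} [TopologicalSpace (Tot A)] (α : BundleAction Γ A)

/-- `α_γ⁻¹(a)`. -/
def invAct (γ : G) (a : Tot A) (h : a.proj = Γ.r γ) : Tot A :=
  ⟨Γ.s γ, (α.iso γ).symm (toFiber a h)⟩

theorem invAct_congr {γ γ' : G} {a a' : Tot A} (hγ : γ = γ') (ha : a = a') (h : a.proj = Γ.r γ)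
    (h' : a'.proj = Γ.r γ') : α.invAct γ a h = α.invAct γ' a' h' := by
  subst hγ ha; rfl

theorem famAct_invAct (γ : G) (a : Tot A) (h : a.proj = Γ.r γ) :
    famAct Γ α.iso γ (α.invAct γ a h) rfl = a := by
  obtain ⟨v, a⟩ := a
  obtain rfl : v = Γ.r γ := h
  exact congrArg (Bundle.TotalSpace.mk (Γ.r γ)) ((α.iso γ).apply_symm_apply a)

theorem famAct_injective (γ : G) {a b : Tot A} (ha : a.proj = Γ.s γ) (hb : b.proj = Γ.s γ)
    (e : famAct Γ α.iso γ a ha = famAct Γ α.iso γ b hb) : a = b := by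
  obtain ⟨v, a⟩ := a
  obtain ⟨w, b⟩ := b
  obtain rfl : v = Γ.s γ := ha
  obtain rfl : w = Γ.s γ := hb
  have e' : α.iso γ a = α.iso γ b := by
    have := (Bundle.TotalSpace.mk.injEq _ _ _ _).mp e
    exact eq_of_heq this.2
  rw [(α.iso γ).injective e']

theorem famAct_congr {γ γ' : G} {a a' : Tot A} (hγ : γ = γ') (ha : a = a') (h : a.proj = Γ.s γ)
    (h' : a'.proj = Γ.s γ') : famAct Γ α.iso γ a h = famAct Γ α.iso γ' a' h' := by
  subst hγ ha; rfl

theorem invAct_mul (γ η : G) (h : Γ.s γ = Γ.r η) (a : Tot A) (ha : a.proj = Γ.r γ) :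
    α.invAct (Γ.mul γ η h) a (ha.trans (Γ.r_mul γ η h).symm)
      = α.invAct η (α.invAct γ a ha) h := by
  refine α.famAct_injective (Γ.mul γ η h) rfl (Γ.s_mul γ η h).symm ?_
  rw [famAct_invAct, α.mul_act γ η h _ rfl]
  exact ((α.famAct_congr rfl (α.famAct_invAct η _ h) h.symm rfl).trans
    (α.famAct_invAct γ a ha)).symm

theorem famAct_unit (a : Tot A) : famAct Γ α.iso (Γ.unit a.proj) a (Γ.s_unit _).symm = a := by
  have h : Γ.s (Γ.unit a.proj) = Γ.r (Γ.unit a.proj) := (Γ.s_unit _).trans (Γ.r_unit _).symm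
  refine α.famAct_injective (Γ.unit a.proj) h.symm (Γ.s_unit _).symm ?_
  rw [← α.mul_act _ _ h]
  refine α.famAct_congr ?_ rfl _ _
  exact (Γ.mul_congr rfl (congrArg _ (Γ.s_unit _).symm) _ _).trans (Γ.mul_unit _)

theorem invAct_unit (a : Tot A) : α.invAct (Γ.unit a.proj) a (Γ.r_unit _).symm = a := by
  refine α.famAct_injective (Γ.unit a.proj) rfl (Γ.s_unit _).symm ?_
  rw [famAct_invAct, famAct_unit]

end BundleAction

end actions

/-! ### The induced bundle -/

section induction

variable [TopologicalSpace G] [TopologicalSpace G₀] {Γ : Gpd G G₀}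
  [TopologicalSpace H] [TopologicalSpace H₀] {Δ : Gpd H H₀} {Z : Type uZ} [TopologicalSpace Z]
  {A : H₀ → Type uA} [∀ v, NonUnitalCStarAlgebra (A v)] [TopologicalSpace (Tot A)]

/-- The pullback `s_Z^* A = {(z, a) ∈ Z × A : s(z) = p(a)}`. -/
def Pullback (E : GpdEquivalence Γ Δ Z) (A : H₀ → Type uA) : Type (max uZ uH0 uA) :=
  {x : Z × Tot A // E.right.anchor x.1 = x.2.proj}

instance (E : GpdEquivalence Γ Δ Z) : TopologicalSpace (Pullback E A) :=
  inferInstanceAs (TopologicalSpace {x : Z × Tot A // E.right.anchor x.1 = x.2.proj})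

variable (E : GpdEquivalence Γ Δ Z) (α : BundleAction Δ A)

/-- The right action `(z, a) • η = (z • η, α_η⁻¹(a))` of `H` on the pullback. -/
def pullAct (x : Pullback E A) (η : H) (h : E.right.anchor x.1.1 = Δ.r η) : Pullback E A :=
  ⟨(E.right.smul x.1.1 η h, α.invAct η x.1.2 (x.2.symm.trans h)), E.right.anchor_smul _ _ _⟩

theorem pullAct_congr {x x' : Pullback E A} {η η' : H} (hx : x = x') (hη : η = η')
    (h : E.right.anchor x.1.1 = Δ.r η) (h' : E.right.anchor x'.1.1 = Δ.r η') :
    pullAct E α x η h = pullAct E α x' η' h' := by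
  subst hx hη; rfl

theorem pullAct_mul (x : Pullback E A) (η θ : H) (h₁ : E.right.anchor x.1.1 = Δ.r η)
    (h₂ : Δ.s η = Δ.r θ) :
    pullAct E α x (Δ.mul η θ h₂) (h₁.trans (Δ.r_mul η θ h₂).symm)
      = pullAct E α (pullAct E α x η h₁) θ ((E.right.anchor_smul _ _ _).trans h₂) :=
  Subtype.ext (Prod.ext (E.right.smul_mul _ _ _ h₁ h₂) (α.invAct_mul _ _ h₂ _ _))

theorem pullAct_unit (x : Pullback E A) :
    pullAct E α x (Δ.unit (E.right.anchor x.1.1)) (Δ.r_unit _).symm = x := by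
  refine Subtype.ext (Prod.ext (E.right.smul_unit _) ?_)
  exact (α.invAct_congr (congrArg _ x.2) rfl _ (Δ.r_unit _).symm).trans (α.invAct_unit _)

theorem pullAct_inv (x : Pullback E A) (η : H) (h : E.right.anchor x.1.1 = Δ.r η) :
    pullAct E α (pullAct E α x η h) (Δ.inv η)
      ((E.right.anchor_smul _ _ _).trans (Δ.r_inv η).symm) = x := by
  rw [← pullAct_mul E α x η (Δ.inv η) h (Δ.r_inv η).symm]
  exact (pullAct_congr E α rfl ((Δ.mul_inv η).trans (congrArg _ h.symm)) _
    (Δ.r_unit _).symm).trans (pullAct_unit E α x)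

/-- The orbit equivalence relation of `H` on the pullback. -/
def pullSetoid : Setoid (Pullback E A) where
  r x y := ∃ η h, pullAct E α x η h = y
  iseqv :=
    { refl := fun x => ⟨_, _, pullAct_unit E α x⟩
      symm := by
        rintro x y ⟨η, h, rfl⟩
        exact ⟨_, _, pullAct_inv E α x η h⟩
      trans := by
        rintro x y w ⟨η, h, rfl⟩ ⟨θ, h', rfl⟩
        exact ⟨_, _, pullAct_mul E α x η θ h ((E.right.anchor_smul _ _ _).symm.trans h')⟩ }

/-- The quotient space `A^Z = s_Z^* A / H`, with the quotient topology. -/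
def IndSpace : Type (max uZ uH0 uA) := Quotient (pullSetoid E α)

instance : TopologicalSpace (IndSpace E α) :=
  inferInstanceAs (TopologicalSpace (Quotient (pullSetoid E α)))

/-- The class `[z, a]`. -/
def IndSpace.mk (z : Z) (a : Tot A) (h : E.right.anchor z = a.proj) : IndSpace E α :=
  Quotient.mk (pullSetoid E α) ⟨(z, a), h⟩

/-- The bundle map `p^Z : A^Z → G₀`, `[z, a] ↦ r_Z(z)`. -/
def IndSpace.proj : IndSpace E α → G₀ :=
  Quotient.lift (fun x : Pullback E A => E.left.anchor x.1.1) (by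
    rintro x y ⟨η, h, rfl⟩
    exact (E.left_anchor_smul _ _ _).symm)

/-- The fibre of `p^Z` over `u`. -/
def IndFiber (u : G₀) : Type (max uZ uH0 uA) := {q : IndSpace E α // IndSpace.proj E α q = u}

/-- The class `[z, a]`, in the fibre over `u = r_Z(z)`. -/
def IndFiber.mk {u : G₀} (z : Z) (hz : E.left.anchor z = u) (a : Tot A)
    (h : E.right.anchor z = a.proj) : IndFiber E α u :=
  ⟨IndSpace.mk E α z a h, hz⟩

theorem IndFiber.mk_bijective {u : G₀} (z : Z) (hz : E.left.anchor z = u) :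
    Function.Bijective fun a : A (E.right.anchor z) => IndFiber.mk E α z hz ⟨_, a⟩ rfl := by
  constructor
  · intro a b hab
    obtain ⟨η, h, e⟩ := Quotient.exact (s := pullSetoid E α) (congrArg Subtype.val hab)
    have e1 : E.right.smul z η h = z := congrArg (fun x => x.1.1) e
    have e2 : α.invAct η ⟨_, a⟩ h = (⟨_, b⟩ : Tot A) := congrArg (fun x => x.1.2) e
    have e3 : η = Δ.unit (E.right.anchor z) :=
      E.right.eq_of_smul_eq E.right_principal h (Δ.r_unit _).symm
        (e1.trans (E.right.smul_unit z).symm)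
    have e4 : (⟨_, a⟩ : Tot A) = ⟨_, b⟩ := by
      rw [← e2]
      exact ((α.invAct_congr e3 rfl h (Δ.r_unit _).symm).trans (α.invAct_unit ⟨_, a⟩)).symm
    exact eq_of_heq ((Bundle.TotalSpace.mk.injEq _ _ _ _).mp e4).2
  · rintro ⟨q, hq⟩
    obtain ⟨x, rfl⟩ := Quotient.exists_rep q
    obtain ⟨η, h, e⟩ := E.exists_right x.1.1 z ((show E.left.anchor x.1.1 = u from hq).trans hz.symm)
    have hx : (pullAct E α x η h).1.2.proj = E.right.anchor z := by
      rw [← (pullAct E α x η h).2]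
      exact congrArg _ e
    refine ⟨toFiber (pullAct E α x η h).1.2 hx, Subtype.ext ?_⟩
    refine (Quotient.sound (s := pullSetoid E α) ⟨η, h, ?_⟩ : _ = _).symm
    refine Subtype.ext (Prod.ext e ?_)
    generalize (pullAct E α x η h).1.2 = c at hx
    obtain ⟨v, c⟩ := c
    obtain rfl : v = _ := hx
    rfl

/-- A point of `Z` over `u`. -/
def basePoint (u : G₀) : Z := (E.left.surjective_anchor u).choose

theorem anchor_basePoint (u : G₀) : E.left.anchor (basePoint E u) = u :=
  (E.left.surjective_anchor u).choose_spec

/-- The identification `[z, a] ↦ a` of the fibre `A^Z_u` with `A_{s(z)}`, where `r_Z(z) = u`. -/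
def indFiberEquiv (u : G₀) : IndFiber E α u ≃ A (E.right.anchor (basePoint E u)) :=
  (Equiv.ofBijective _ (IndFiber.mk_bijective E α (basePoint E u) (anchor_basePoint E u))).symm

/-- Transport of a C⋆-algebra structure along a bijection. -/
@[reducible] def cstarTransport {S : Type uX} {T : Type uA} [NonUnitalCStarAlgebra T] (e : S ≃ T) :
    NonUnitalCStarAlgebra S :=
  letI : NonUnitalRing S := e.nonUnitalRing
  letI : Module ℂ S := e.module ℂ
  letI : NonUnitalNormedRing S :=
    NonUnitalNormedRing.induced S T
      ({ toFun := e, map_zero' := e.apply_symm_apply _, map_add' := fun _ _ => e.apply_symm_apply _,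
         map_mul' := fun _ _ => e.apply_symm_apply _ } : S →ₙ+* T) e.injective
  letI : NormedSpace ℂ S :=
    { norm_smul_le := fun c x => by
        change ‖e (e.symm (c • e x))‖ ≤ ‖c‖ * ‖e x‖
        rw [e.apply_symm_apply]
        exact norm_smul_le c (e x) }
  letI : StarRing S :=
    { star := fun x => e.symm (star (e x))
      star_involutive := fun x => by simp
      star_mul := fun x y => by
        change e.symm (star (e (e.symm (e x * e y))))
          = e.symm (e (e.symm (star (e y))) * e (e.symm (star (e x))))
        simp
      star_add := fun x y => by
        change e.symm (star (e (e.symm (e x + e y))))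
          = e.symm (e (e.symm (star (e x))) + e (e.symm (star (e y))))
        simp }
  { complete := fun {f} hf => by
      have hi : Isometry e := Isometry.of_dist_eq fun _ _ => rfl
      have hu : IsUniformInducing e := hi.isUniformInducing
      have : CompleteSpace S :=
        (completeSpace_congr (e := e) ⟨hu, e.injective⟩).mpr inferInstance
      exact CompleteSpace.complete hf
    norm_mul_self_le := fun x => by
      change ‖e x‖ * ‖e x‖ ≤ ‖e (e.symm (e (e.symm (star (e x))) * e x))‖
      simp only [e.apply_symm_apply]
      exact CStarRing.norm_mul_self_le (e x)
    smul_assoc := fun c x y => by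
      change e.symm (e (e.symm (c • e x)) * e y) = e.symm (c • e (e.symm (e x * e y)))
      simp [smul_mul_assoc]
    smul_comm := fun c x y => by
      change e.symm (c • e (e.symm (e x * e y))) = e.symm (e x * e (e.symm (c • e y)))
      simp [mul_smul_comm]
    star_smul := fun c x => by
      change e.symm (star (e (e.symm (c • e x)))) = e.symm (star c • e (e.symm (star (e x))))
      simp }

/-- The C⋆-algebra structure of the fibre `A^Z_u`: for a point `z` with `r_Z(z) = u`, the bijection
`a ↦ [z, a]` from `A_{s(z)}` is an isomorphism. -/
instance (u : G₀) : NonUnitalCStarAlgebra (IndFiber E α u) := cstarTransport (indFiberEquiv E α u)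

end induction

/-! ### The bundle over the unit space of the linking groupoid -/

section linkBundle

variable [TopologicalSpace G] [TopologicalSpace G₀] {Γ : Gpd G G₀}
  [TopologicalSpace H] {H₀ : Type u} [TopologicalSpace H₀] {Δ : Gpd H H₀}
  {Z : Type u} [TopologicalSpace Z]
  {A : H₀ → Type u} [∀ v, NonUnitalCStarAlgebra (A v)] [TopologicalSpace (Tot A)]
  (E : GpdEquivalence Γ Δ Z) (α : BundleAction Δ A)

/-- The bundle `B = A^Z ⊔ A` over `G₀ ⊔ H₀`. -/
def LinkBundle : G₀ ⊕ H₀ → Type u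
  | .inl u => IndFiber E α u
  | .inr v => A v

instance : ∀ w, NonUnitalCStarAlgebra (LinkBundle E α w)
  | .inl u => inferInstanceAs (NonUnitalCStarAlgebra (IndFiber E α u))
  | .inr v => inferInstanceAs (NonUnitalCStarAlgebra (A v))

/-- The bijection of the total space of `B` with the disjoint union of the spaces `A^Z` and `A`. -/
def LinkBundle.toSum : Tot (LinkBundle E α) → IndSpace E α ⊕ Tot A
  | ⟨.inl _, q⟩ => .inl (Subtype.val q)
  | ⟨.inr v, a⟩ => .inr ⟨v, a⟩

/-- The total space of `B` is the topological disjoint union of `A^Z` and `A`. -/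
instance : TopologicalSpace (Tot (LinkBundle E α)) :=
  TopologicalSpace.induced (LinkBundle.toSum E α) inferInstance

end linkBundle

end GpdDyn

end

/-! Everything rests on the formula `[z, a] = β_z(a)`. It forces `β_k([z, a]) = β_{kz}(a)` whenever
`kz` is again in `Z`, and where `kz` is an arrow `η` of `H` it forces `α_η(a)`. With `β` so defined,
multiplicativity on classes `[x, a]` becomes the associativity law `(kl)x = k(lx)`, with the point
`x` of `Z` as a third arrow, together with multiplicativity of `α`. On vectors of `A` it is read off
from the explicit formulas for `β` and from `[z, α_η(a)] = [z · η, a]`.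

The topology has two sources. Since the actions on `Z` are free and proper, `(z, η) ↦ (z, z · η)` is
a closed embedding, so the division map `(z, w) ↦ [z, w]_H` is continuous (`continuous_rbr`, and
symmetrically `continuous_lbr`); these are the only products in `L` whose continuity is not given in
advance. Since the anchor maps are open, the range map of `H` is open (`isOpenMap_r`), and therefore
so is the quotient map from `s_Z^* A` onto `A^Z` (`isOpenMap_quotient`). Hence a function on `B`, or
on pairs in `B`, is continuous once it is continuous on representatives. Two classes over the same
unit are brought over the same `z` by `[w, b] = [z, α_{[z,w]}(b)]`, which depends continuously on
the data; this gives the continuity of the fibrewise operations, and the same identity gives the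
axiom on neighbourhoods of zero.

Separability is transferred through the total spaces. Over a locally compact Hausdorff second
countable base a separable section algebra makes the total space second countable
(`secondCountable_of_separable`). Second countability passes to subspaces, open quotients and
disjoint unions, thus from `A` to `B`, and a second countable total space over a suitable base gives
back a separable section algebra (`separable_of_secondCountable`). The first implication needs a
continuous section close to any given vector. Such sections are built by successive approximation:
choose vectors in a small open set to get a section that is continuous up to a small error, patch
with a partition of unity to halve the error, and pass to the uniform limit. -/

noncomputable section

namespace GpdDyn

/-! ### Almost continuous sections of upper semicontinuous C⋆-bundles -/

section sections

variable {X : Type uX} {A : X → Type uA} [∀ x, NonUnitalCStarAlgebra (A x)]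
  [TopologicalSpace (Tot A)]

/-- Near the point `b` of the total space, the section `f` has distance at most `ε` (asymptotically)
from the points of the total space. -/
def NearAt (f : ∀ x, A x) {x : X} (b : A x) (ε : ℝ) : Prop :=
  ∀ δ > ε, ∀ᶠ c in 𝓝 (⟨x, b⟩ : Tot A), ‖f c.proj - c.2‖ < δ

namespace NearAt

variable {f g : ∀ x, A x} {x : X} {b c : A x} {ε ε' r : ℝ}

theorem norm_sub_le (h : NearAt f b ε) : ‖f x - b‖ ≤ ε :=
  le_of_forall_gt_imp_ge_of_dense fun δ hδ => (h δ hδ).self_of_nhds.le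

theorem mono (h : NearAt f b ε) (hε : ε ≤ ε') : NearAt f b ε' :=
  fun δ hδ => h δ (hε.trans_lt hδ)

theorem of_norm_sub_le (h : NearAt f b ε) (hfg : ∀ y, ‖g y - f y‖ ≤ r) :
    NearAt g b (ε + r) := fun δ hδ => by
  filter_upwards [h (δ - r) (by linarith)] with c hc
  have := norm_sub_le_norm_sub_add_norm_sub (g c.proj) (f c.proj) c.2
  linarith [hfg c.proj]

end NearAt

variable [TopologicalSpace X]

namespace IsUSCCStarBundle

theorem exists_nhds_add (hA : IsUSCCStarBundle A) {x : X} {b c : A x} {W : Set (Tot A)}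
    (hW : W ∈ 𝓝 (⟨x, b + c⟩ : Tot A)) :
    ∃ U ∈ 𝓝 (⟨x, b⟩ : Tot A), ∃ V ∈ 𝓝 (⟨x, c⟩ : Tot A), ∀ y (b' c' : A y),
      (⟨y, b'⟩ : Tot A) ∈ U → (⟨y, c'⟩ : Tot A) ∈ V → (⟨y, b' + c'⟩ : Tot A) ∈ W := by
  have h := hA.continuous_add.continuousAt
    (x := ⟨((⟨x, b⟩ : Tot A), (⟨x, c⟩ : Tot A)), rfl⟩) hW
  rw [mem_map, nhds_subtype_eq_comap, mem_comap] at h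
  obtain ⟨t, ht, hts⟩ := h
  obtain ⟨U, hU, V, hV, hUV⟩ := mem_nhds_prod_iff.1 ht
  exact ⟨U, hU, V, hV, fun y b' c' hb hc => hts (a := ⟨(⟨y, b'⟩, ⟨y, c'⟩), rfl⟩)
    (hUV (Set.mk_mem_prod hb hc))⟩

theorem exists_nhds_sub (hA : IsUSCCStarBundle A) {x : X} {b c : A x} {W : Set (Tot A)}
    (hW : W ∈ 𝓝 (⟨x, b - c⟩ : Tot A)) :
    ∃ U ∈ 𝓝 (⟨x, b⟩ : Tot A), ∃ V ∈ 𝓝 (⟨x, c⟩ : Tot A), ∀ y (b' c' : A y),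
      (⟨y, b'⟩ : Tot A) ∈ U → (⟨y, c'⟩ : Tot A) ∈ V → (⟨y, b' - c'⟩ : Tot A) ∈ W := by
  have e : ∀ y (d d' : A y), d - d' = d + (-1 : ℂ) • d' := fun y d d' => by
    rw [neg_one_smul, sub_eq_add_neg]
  rw [e] at hW
  obtain ⟨U, hU, V, hV, h⟩ := hA.exists_nhds_add hW
  refine ⟨U, hU, _, (hA.continuous_smul (-1)).continuousAt (x := (⟨x, c⟩ : Tot A)) hV, ?_⟩
  intro y b' c' hb hc
  rw [e]
  exact h y b' _ hb hc

theorem exists_nhds_norm_sub_lt (hA : IsUSCCStarBundle A) {x : X} {b c : A x} {ε : ℝ}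
    (h : ‖b - c‖ < ε) :
    ∃ U ∈ 𝓝 (⟨x, b⟩ : Tot A), ∃ V ∈ 𝓝 (⟨x, c⟩ : Tot A), ∀ y (b' c' : A y),
      (⟨y, b'⟩ : Tot A) ∈ U → (⟨y, c'⟩ : Tot A) ∈ V → ‖b' - c'‖ < ε :=
  hA.exists_nhds_sub (W := {a | ‖a.2‖ < ε}) (hA.usc_norm ⟨x, b - c⟩ ε h)

/-- This is the form in which openness of the projection is used below: it supplies, over every
nearby point of the base, an auxiliary vector close to a given one. -/
theorem eventually_exists_mem (hA : IsUSCCStarBundle A) {x : X} {b : A x} {U : Set (Tot A)}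
    (hU : U ∈ 𝓝 (⟨x, b⟩ : Tot A)) : ∀ᶠ y in 𝓝 x, ∃ b' : A y, (⟨y, b'⟩ : Tot A) ∈ U := by
  filter_upwards [hA.isOpenMap_proj.image_mem_nhds hU] with y hy
  obtain ⟨⟨y, b'⟩, hb, rfl⟩ := hy
  exact ⟨b', hb⟩

theorem eventually_proj (hA : IsUSCCStarBundle A) {x : X} (b : A x) {p : X → Prop}
    (h : ∀ᶠ y in 𝓝 x, p y) : ∀ᶠ c in 𝓝 (⟨x, b⟩ : Tot A), p c.proj :=
  hA.continuous_proj.continuousAt (x := (⟨x, b⟩ : Tot A)) h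

/-- Every neighborhood contains a uniform fibrewise neighborhood of a smaller neighborhood. -/
theorem exists_nhds_thickening (hA : IsUSCCStarBundle A) {x : X} {b : A x} {W : Set (Tot A)}
    (hW : W ∈ 𝓝 (⟨x, b⟩ : Tot A)) :
    ∃ U ∈ 𝓝 (⟨x, b⟩ : Tot A), ∃ ε > 0, ∀ y (c d : A y), (⟨y, c⟩ : Tot A) ∈ U → ‖d - c‖ < ε →
      (⟨y, d⟩ : Tot A) ∈ W := by
  rw [← add_zero b] at hW
  obtain ⟨U, hU, V, hV, h⟩ := hA.exists_nhds_add hW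
  obtain ⟨t, ht, hts⟩ := mem_comap.1 (hA.zero_nhds x hV)
  obtain ⟨N, hN, R, hR, hNR⟩ := mem_nhds_prod_iff.1 ht
  obtain ⟨ε, hε, hεR⟩ := Metric.mem_nhds_iff.1 hR
  refine ⟨U ∩ {c | c.proj ∈ N}, inter_mem hU (hA.eventually_proj b hN), ε, hε, ?_⟩
  rintro y c d ⟨hcU, hcN⟩ hd
  -- The difference `d - c` is small in norm over a point near `x`, hence near `0_x` by `zero_nhds`;
  -- continuity of addition at `(b, 0)` does the rest.
  have : (⟨y, d⟩ : Tot A) = ⟨y, c + (d - c)⟩ := by rw [add_sub_cancel]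
  rw [this]
  refine h y c (d - c) hcU (hts (hNR ⟨hcN, hεR ?_⟩))
  simpa using hd

end IsUSCCStarBundle

namespace NearAt

variable {f g : ∀ x, A x} {x : X} {b c : A x} {ε ε' r : ℝ}

theorem congr (hA : IsUSCCStarBundle A) (h : NearAt f b ε) (hfg : ∀ᶠ y in 𝓝 x, f y = g y) :
    NearAt g b ε := fun δ hδ => by
  filter_upwards [h δ hδ, hA.eventually_proj b hfg] with c hc e
  rwa [← e]

theorem zero (hA : IsUSCCStarBundle A) (x : X) : NearAt (fun x => (0 : A x)) (0 : A x) 0 :=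
  fun δ hδ => by
    filter_upwards [hA.usc_norm (⟨x, 0⟩ : Tot A) δ (by simpa using hδ)] with c hc
    simpa using hc

/-- Over each base point near `x` there is a vector `b'` near `b`, at which the estimate for `f`
applies. By upper semicontinuity its distance to a vector near `c` exceeds `r` by arbitrarily
little, and the triangle inequality adds the two errors. -/
theorem move (hA : IsUSCCStarBundle A) (h : NearAt f b ε) (hbc : ‖b - c‖ ≤ r) :
    NearAt f c (ε + r) := fun δ hδ => by
  obtain ⟨U, hU, V, hV, hUV⟩ := hA.exists_nhds_norm_sub_lt (b := b) (c := c)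
    (ε := r + (δ - (ε + r)) / 2) (by linarith)
  have h1 := hA.eventually_exists_mem (inter_mem hU (h (ε + (δ - (ε + r)) / 2) (by linarith)))
  filter_upwards [hA.eventually_proj c h1, hV] with d hd hdV
  obtain ⟨b', hb', hb''⟩ := hd
  have h2 := hUV _ b' d.2 hb' hdV
  have h3 : ‖f d.proj - b'‖ < ε + (δ - (ε + r)) / 2 := hb''
  have := norm_sub_le_norm_sub_add_norm_sub (f d.proj) b' d.2
  linarith

theorem self (hA : IsUSCCStarBundle A) (h : NearAt f b ε) : NearAt f (f x) (2 * ε) := by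
  rw [two_mul]
  exact h.move hA (by rw [norm_sub_rev]; exact h.norm_sub_le)

/-- A vector `d` near `b + c` splits as `(d - c') + c'` with `c'` near `c` in the same fibre; then
`d - c'` is near `b` and each section is compared with its own summand. -/
theorem add (hA : IsUSCCStarBundle A) (hf : NearAt f b ε) (hg : NearAt g c ε') :
    NearAt (fun y => f y + g y) (b + c) (ε + ε') := fun δ hδ => by
  set τ := (δ - (ε + ε')) / 2 with hτ
  have hf' := hf (ε + τ) (by linarith)
  have hg' := hg (ε' + τ) (by linarith)
  rw [← add_sub_cancel_right b c] at hf'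
  obtain ⟨U, hU, V, hV, hUV⟩ := hA.exists_nhds_sub hf'
  filter_upwards [hU, hA.eventually_proj (b + c) (hA.eventually_exists_mem (inter_mem hV hg'))]
    with d hd hd'
  obtain ⟨c', hc', hc''⟩ := hd'
  have h1 : ‖f d.proj - (d.2 - c')‖ < ε + τ := hUV _ d.2 c' hd hc'
  have h2 : ‖g d.proj - c'‖ < ε' + τ := hc''
  have h3 : f d.proj + g d.proj - d.2 = (f d.proj - (d.2 - c')) + (g d.proj - c') := by abel
  rw [h3]
  linarith [norm_add_le (f d.proj - (d.2 - c')) (g d.proj - c')]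

/-- The axioms give continuity only for multiplication by a fixed scalar. The variation of `φ` is
therefore absorbed in the norm estimate, with `‖e‖` bounded near `b` by upper semicontinuity. The
error scales by `φ x`, which is what makes a partition of unity average the errors. -/
theorem smul (hA : IsUSCCStarBundle A) (hf : NearAt f b ε) {φ : X → ℝ} (hφ : Continuous φ)
    (h0 : 0 ≤ φ x) : NearAt (fun y => φ y • f y) (φ x • b) (φ x * ε) := fun δ hδ => by
  have hε : 0 ≤ ε := (norm_nonneg _).trans hf.norm_sub_le
  obtain ⟨τ, hτ, hτ'⟩ : ∃ τ > 0, (φ x + τ) * (ε + τ) + τ * (‖b‖ + 1) + τ < δ := by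
    have : Tendsto (fun τ : ℝ => (φ x + τ) * (ε + τ) + τ * (‖b‖ + 1) + τ) (𝓝[>] 0)
        (𝓝 (φ x * ε)) := by
      refine Tendsto.mono_left ?_ nhdsWithin_le_nhds
      have : Continuous fun τ : ℝ => (φ x + τ) * (ε + τ) + τ * (‖b‖ + 1) + τ := by fun_prop
      simpa using this.tendsto 0
    obtain ⟨τ, h1, h2⟩ := ((this.eventually (gt_mem_nhds hδ)).and self_mem_nhdsWithin).exists
    exact ⟨τ, h2, h1⟩
  have hs : ContinuousAt (fun a : Tot A => (⟨a.proj, φ x • a.2⟩ : Tot A)) ⟨x, b⟩ := by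
    simpa only [Complex.coe_smul] using (hA.continuous_smul (φ x : ℂ)).continuousAt
  obtain ⟨U, hU, V, hV, hUV⟩ := hA.exists_nhds_norm_sub_lt (b := φ x • b) (c := φ x • b)
    (ε := τ) (by simpa using hτ)
  have h1 : ∀ᶠ c in 𝓝 (⟨x, b⟩ : Tot A), ‖f c.proj - c.2‖ < ε + τ := hf _ (by linarith)
  have h2 : ∀ᶠ c in 𝓝 (⟨x, b⟩ : Tot A), ‖c.2‖ < ‖b‖ + 1 :=
    hA.usc_norm (⟨x, b⟩ : Tot A) _ (by simp)
  have h3 := hA.eventually_exists_mem (inter_mem (inter_mem (hs hU) h1) h2)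
  have h4 : ∀ᶠ y in 𝓝 x, |φ y - φ x| < τ := by
    have := hφ.continuousAt (Metric.ball_mem_nhds (φ x) hτ)
    filter_upwards [this] with y hy
    simpa [Real.dist_eq] using hy
  filter_upwards [hV, hA.eventually_proj _ h3, hA.eventually_proj _ h4] with c hcV hc hcφ
  obtain ⟨e, ⟨he1, he2⟩, he3⟩ := hc
  have k1 : ‖φ x • e - c.2‖ < τ := hUV _ (φ x • e) c.2 he1 hcV
  have k2 : ‖f c.proj - e‖ < ε + τ := he2
  have k3 : ‖e‖ < ‖b‖ + 1 := he3
  have k4 : φ c.proj • f c.proj - c.2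
      = φ c.proj • (f c.proj - e) + (φ c.proj - φ x) • e + (φ x • e - c.2) := by
    rw [smul_sub, sub_smul]; abel
  rw [k4]
  have k5 : |φ c.proj| ≤ φ x + τ := by
    rw [abs_le]; rw [abs_lt] at hcφ; constructor <;> linarith
  calc _ ≤ ‖φ c.proj • (f c.proj - e)‖ + ‖(φ c.proj - φ x) • e‖ + ‖φ x • e - c.2‖ :=
        norm_add₃_le
    _ ≤ (φ x + τ) * (ε + τ) + τ * (‖b‖ + 1) + τ := by
        rw [norm_smul, norm_smul, Real.norm_eq_abs, Real.norm_eq_abs]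
        gcongr
    _ < δ := hτ'

theorem sum (hA : IsUSCCStarBundle A) {ι : Type*} (I : Finset ι) {F : ι → ∀ x, A x} {B : ι → A x}
    {η : ι → ℝ} (h : ∀ i ∈ I, NearAt (F i) (B i) (η i)) :
    NearAt (fun y => ∑ i ∈ I, F i y) (∑ i ∈ I, B i) (∑ i ∈ I, η i) := by
  classical
  induction I using Finset.induction_on with
  | empty => simpa using NearAt.zero hA x
  | insert i I hi ih =>
    simp only [Finset.sum_insert hi]
    exact (h i (Finset.mem_insert_self i I)).add hA
      (ih fun j hj => h j (Finset.mem_insert_of_mem hj))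

end NearAt

/-- Continuity is thus the case of error zero. For the converse, a vector near `f x` over a nearby
`y` is norm-close to `f y`, so the thickening lemma places `f y` in the prescribed neighbourhood. -/
theorem IsUSCCStarBundle.continuous_section_iff (hA : IsUSCCStarBundle A) {f : ∀ x, A x} :
    Continuous (fun x => (⟨x, f x⟩ : Tot A)) ↔ ∀ x, NearAt f (f x) 0 := by
  constructor
  · intro hf x δ hδ
    obtain ⟨U, hU, V, hV, hUV⟩ := hA.exists_nhds_norm_sub_lt (b := f x) (c := f x)
      (ε := δ) (by simpa using hδ)
    filter_upwards [hV, hA.eventually_proj _ (hf.continuousAt hU)] with c hc hc'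
    exact hUV _ _ c.2 hc' hc
  · intro h
    refine continuous_iff_continuousAt.2 fun x W hW => ?_
    obtain ⟨U, hU, ε, hε, hUε⟩ := hA.exists_nhds_thickening hW
    rw [mem_map]
    filter_upwards [hA.eventually_exists_mem (inter_mem hU (h x ε hε))] with y hy
    obtain ⟨c, hc, hc'⟩ := hy
    exact hUε y c (f y) hc hc'

end sections

/-! ### Existence of continuous sections; separability and second countability -/

section sections

variable {X : Type uX} {A : X → Type uA} [TopologicalSpace X] [∀ x, NonUnitalCStarAlgebra (A x)]
  [TopologicalSpace (Tot A)]

namespace IsUSCCStarBundle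

/-- Through a neighborhood of each point there is a locally defined section that is almost
continuous. -/
theorem exists_local_nearAt (hA : IsUSCCStarBundle A) {x : X} (b : A x) {ε : ℝ} (hε : 0 < ε)
    {W : Set (Tot A)} (hW : W ∈ 𝓝 (⟨x, b⟩ : Tot A)) :
    ∃ V : Set X, IsOpen V ∧ x ∈ V ∧ ∃ g : ∀ y, A y, g x = b ∧
      ∀ y ∈ V, (⟨y, g y⟩ : Tot A) ∈ W ∧ NearAt g (g y) ε := by
  classical
  obtain ⟨U, hU, U', hU', hUU⟩ := hA.exists_nhds_norm_sub_lt (b := b) (c := b)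
    (ε := ε) (by simpa using hε)
  obtain ⟨O, hO, hOo, hbO⟩ := mem_nhds_iff.1 (inter_mem (inter_mem hU hU') hW)
  -- The vectors may be chosen arbitrarily in `O`: two points of `O` in one fibre are at distance
  -- less than `ε`, so every choice is continuous up to `ε`. The value at `x` is afterwards reset to
  -- `b`.
  have key : ∀ y, ∃ c : A y, y ∈ (fun a : Tot A => a.proj) '' O → (⟨y, c⟩ : Tot A) ∈ O := by
    intro y
    by_cases hy : y ∈ (fun a : Tot A => a.proj) '' O
    · obtain ⟨⟨y, c⟩, hc, rfl⟩ := hy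
      exact ⟨c, fun _ => hc⟩
    · exact ⟨0, fun h => (hy h).elim⟩
  choose g hg using key
  have hx : x ∈ (fun a : Tot A => a.proj) '' O := ⟨_, hbO, rfl⟩
  have hgO : ∀ y ∈ (fun a : Tot A => a.proj) '' O,
      (⟨y, Function.update g x b y⟩ : Tot A) ∈ O := by
    intro y hy
    by_cases hyx : y = x
    · subst hyx
      simpa using hbO
    · rw [Function.update_of_ne hyx]
      exact hg y hy
  refine ⟨_, hA.isOpenMap_proj O hOo, hx, Function.update g x b, Function.update_self .., ?_⟩
  intro y hy
  refine ⟨(hO (hgO y hy)).2, fun δ hδ => ?_⟩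
  filter_upwards [hOo.mem_nhds (hgO y hy)] with c hc
  exact (hUU _ _ c.2 (hO (hgO c.proj ⟨c, hc, rfl⟩)).1.1 (hO hc).1.2).trans hδ

/-- An almost continuous section can be approximated by more continuous ones. -/
theorem exists_nearAt_improve [NormalSpace X] [ParacompactSpace X] (hA : IsUSCCStarBundle A)
    {f : ∀ x, A x} {ε ε' : ℝ} (hε' : 0 < ε') (hf : ∀ x, NearAt f (f x) ε) :
    ∃ g : ∀ x, A x, (∀ x, NearAt g (g x) ε') ∧ ∀ x, ‖g x - f x‖ ≤ ε + ε' := by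
  -- The prescribed neighbourhood of `f x` is the tube of radius `ε + ε'` around `f`, so each local
  -- section stays that close to `f`.
  have h1 := fun x => hA.exists_local_nearAt (f x) hε' (hf x (ε + ε') (by linarith))
  choose V hVo hxV g hgx hg using h1
  obtain ⟨φ, hφ⟩ := PartitionOfUnity.exists_isSubordinate isClosed_univ V hVo
    fun x _ => Set.mem_iUnion.2 ⟨x, hxV x⟩
  refine ⟨fun y => ∑ᶠ i, φ i y • g i y, fun x => ?_, fun x => ?_⟩
  · obtain ⟨I, hI⟩ := φ.exists_finset_nhds x
    have hsum : ∀ᶠ y in 𝓝 x, ∑ i ∈ I, φ i y • g i y = ∑ᶠ i, φ i y • g i y := by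
      filter_upwards [hI] with y hy
      refine (finsum_eq_sum_of_support_subset _ fun i hi => hy.2 ?_).symm
      rw [Function.mem_support] at hi ⊢
      exact fun h0 => hi (by rw [h0, zero_smul])
    have hone : ∑ i ∈ I, φ i x = 1 := hI.self_of_nhds.1
    have key : NearAt (fun y => ∑ i ∈ I, φ i y • g i y) (∑ i ∈ I, φ i x • g i x)
        (∑ i ∈ I, φ i x * ε') := by
      refine NearAt.sum hA I fun i _ => ?_
      by_cases hi : x ∈ tsupport (φ i)
      · exact (hg i x (hφ i hi)).2.smul hA (φ i).continuous (φ.nonneg i x)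
      · have h0 := notMem_tsupport_iff_eventuallyEq.1 hi
        have h0x : φ i x = 0 := h0.self_of_nhds
        rw [h0x, zero_smul, zero_mul]
        refine (NearAt.zero hA x).congr hA ?_
        filter_upwards [h0] with y hy
        simp only [hy, Pi.zero_apply, zero_smul]
    rw [← Finset.sum_mul, hone, one_mul] at key
    beta_reduce
    rw [← hsum.self_of_nhds]
    exact key.congr hA hsum
  -- A convex combination of points of the closed ball of radius `ε + ε'` about `f x` stays in it.
  · have := φ.finsum_smul_mem_convex (g := fun i _ => g i x) (Set.mem_univ x)
      (fun i hi => ?_) (convex_closedBall (f x) (ε + ε'))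
    · simpa [dist_eq_norm] using this
    · have := (hg i x (hφ i (subset_tsupport _ hi))).1
      have h2 : ‖f x - g i x‖ < ε + ε' := this
      rw [mem_closedBall_iff_norm, norm_sub_rev]
      exact h2.le

/-- Almost continuous sections are close to continuous ones. -/
theorem exists_continuous_section_near [NormalSpace X] [ParacompactSpace X]
    (hA : IsUSCCStarBundle A) {f : ∀ x, A x} {ε : ℝ} (hε : 0 < ε) (hf : ∀ x, NearAt f (f x) ε) :
    ∃ g : ∀ x, A x, Continuous (fun x => (⟨x, g x⟩ : Tot A)) ∧ ∀ x, ‖g x - f x‖ ≤ 4 * ε := by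
  let S (n : ℕ) : Type _ := {f : ∀ x, A x // ∀ x, NearAt f (f x) (ε / 2 ^ n)}
  have step : ∀ n (f : S n), ∃ g : S (n + 1), ∀ x, ‖f.1 x - g.1 x‖ ≤ 2 * ε / 2 ^ n := by
    intro n f
    obtain ⟨g, hg, hgf⟩ := hA.exists_nearAt_improve (ε' := ε / 2 ^ (n + 1)) (by positivity) f.2
    refine ⟨⟨g, hg⟩, fun x => ?_⟩
    rw [norm_sub_rev]
    refine (hgf x).trans ?_
    rw [pow_succ, mul_comm (2 ^ n) 2, ← div_div]
    have h2 : 0 ≤ ε / 2 ^ n := by positivity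
    have h3 : ε / 2 / 2 ^ n = ε / 2 ^ n / 2 := by ring
    have h4 : 2 * ε / 2 ^ n = 2 * (ε / 2 ^ n) := by ring
    rw [h3, h4]
    linarith
  choose next hnext using step
  let F : ∀ n, S n := fun n => Nat.rec ⟨f, by simpa using hf⟩ (fun n f => next n f) n
  -- The `n`-th step moves the section by at most `2ε / 2 ^ n`; the sum of these bounds is the
  -- constant `4 * ε` of the statement.
  have hF : ∀ x n, dist ((F n).1 x) ((F (n + 1)).1 x) ≤ (4 * ε) / 2 / 2 ^ n := fun x n => by
    rw [dist_eq_norm, show 4 * ε / 2 = 2 * ε by ring]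
    exact hnext n (F n) x
  have hlim : ∀ x, ∃ a, Tendsto (fun n => (F n).1 x) atTop (𝓝 a) := fun x =>
    cauchySeq_tendsto_of_complete (cauchySeq_of_le_geometric_two (hF x))
  choose g hg using hlim
  have hgF : ∀ x n, ‖g x - (F n).1 x‖ ≤ 4 * ε / 2 ^ n := fun x n => by
    rw [← dist_eq_norm, dist_comm]
    exact dist_le_of_le_geometric_two_of_tendsto (hF x) (hg x) n
  refine ⟨g, hA.continuous_section_iff.2 fun x => ?_, fun x => ?_⟩
  swap
  · calc ‖g x - f x‖ ≤ 4 * ε / 2 ^ 0 := hgF x 0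
      _ = 4 * ε := by simp
  -- The limit inherits the error of the `n`-th approximation plus its uniform distance from it,
  -- measured at the value of that approximation; recentring at `g x` doubles the bound, which still
  -- tends to zero.
  have h1 : ∀ n, NearAt g (g x) (2 * (ε / 2 ^ n + 4 * ε / 2 ^ n)) := fun n =>
    NearAt.self hA (((F n).2 x).of_norm_sub_le fun y => hgF y n)
  have h2 : Tendsto (fun n : ℕ => 2 * (ε / 2 ^ n + 4 * ε / 2 ^ n)) atTop (𝓝 0) := by
    have h3 := (tendsto_pow_atTop_nhds_zero_of_lt_one (r := (1 / 2 : ℝ)) (by norm_num)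
      (by norm_num)).const_mul (10 * ε)
    rw [mul_zero] at h3
    refine h3.congr fun n => ?_
    rw [one_div, inv_pow]
    ring
  intro δ hδ
  obtain ⟨n, hn⟩ := (h2.eventually (gt_mem_nhds hδ)).exists
  exact h1 n δ hn

/-- Multiplication of a continuous section by a continuous function. -/
theorem continuous_section_smul (hA : IsUSCCStarBundle A) {f : ∀ x, A x}
    (hf : Continuous fun x => (⟨x, f x⟩ : Tot A)) {φ : X → ℝ} (hφ : Continuous φ)
    (h0 : ∀ x, 0 ≤ φ x) : Continuous fun x => (⟨x, φ x • f x⟩ : Tot A) :=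
  hA.continuous_section_iff.2 fun x => by
    simpa using (hA.continuous_section_iff.1 hf x).smul hA hφ (h0 x)

/-- An upper semicontinuous C⋆-bundle over a locally compact second countable Hausdorff space has
enough sections. -/
theorem exists_c0Section_near [LocallyCompactSpace X] [T2Space X] [SecondCountableTopology X]
    (hA : IsUSCCStarBundle A) {x : X} (b : A x) {ε : ℝ} (hε : 0 < ε) :
    ∃ f : C0Section A, ‖f.toFun x - b‖ ≤ ε := by
  obtain ⟨V, hVo, hxV, g, hgx, hg⟩ := hA.exists_local_nearAt b (ε := ε / 4) (by positivity) univ_mem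
  obtain ⟨φ, hφ1, hφc, hφs, hφ01⟩ : ∃ φ : C(X, ℝ), φ x = 1 ∧ HasCompactSupport φ ∧
      tsupport φ ⊆ V ∧ ∀ y, φ y ∈ Set.Icc (0 : ℝ) 1 := by
    obtain ⟨K, hK, hxK, hKV⟩ := exists_compact_subset hVo hxV
    obtain ⟨φ, h1, h2, h3, h4⟩ := exists_continuous_one_zero_of_isCompact
      (isCompact_singleton (x := x)) isOpen_interior.isClosed_compl
      (Set.disjoint_compl_right_iff_subset.2 (Set.singleton_subset_iff.2 hxK))
    refine ⟨φ, h1 rfl, h3, ?_, h4⟩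
    refine (closure_minimal (fun y hy => ?_) hK.isClosed).trans hKV
    by_contra hyK
    exact hy (h2 fun hi => hyK (interior_subset hi))
  -- On the support of `φ` this is scaling by a number at most one; off it the section vanishes near
  -- `y`. The constant `ε / 4` compensates the factor 4 of `exists_continuous_section_near`.
  have hf0 : ∀ y, NearAt (fun y => φ y • g y) (φ y • g y) (ε / 4) := fun y => by
    by_cases hy : y ∈ tsupport φ
    · refine ((hg y (hφs hy)).2.smul hA φ.continuous (hφ01 y).1).mono ?_
      exact mul_le_of_le_one_left (by positivity) (hφ01 y).2
    · have h0 := notMem_tsupport_iff_eventuallyEq.1 hy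
      have h0y : φ y = 0 := h0.self_of_nhds
      rw [h0y, zero_smul]
      refine ((NearAt.zero hA y).congr hA ?_).mono (by positivity)
      filter_upwards [h0] with z hz
      simp only [hz, Pi.zero_apply, zero_smul]
  obtain ⟨f, hf, hff⟩ := hA.exists_continuous_section_near (by positivity) hf0
  -- The continuous approximation `f` need not vanish at infinity, so it is cut off once more; since
  -- `φ x = 1` the value at `x` is unchanged.
  refine ⟨⟨fun y => φ y • f y, hA.continuous_section_smul hf φ.continuous fun y => (hφ01 y).1, ?_⟩,
    ?_⟩
  · refine tendsto_const_nhds.congr' ?_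
    filter_upwards [hφc.compl_mem_cocompact] with y hy
    rw [image_eq_zero_of_notMem_tsupport hy, zero_smul, norm_zero]
  · have := hff x
    simp only [hφ1, one_smul, hgx] at this ⊢
    linarith

/-- If the section algebra is separable then the total space is second countable. -/
theorem secondCountable_of_separable [LocallyCompactSpace X] [T2Space X]
    [SecondCountableTopology X] (hA : IsUSCCStarBundle A) (hS : HasSeparableSections A) :
    SecondCountableTopology (Tot A) := by
  obtain ⟨S, hSc, hS⟩ := hS
  -- Tubes of radius `1 / (n + 1)` around sections, restricted to base sets; those with `f` in the
  -- dense set and `U` in a countable basis will form the basis.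
  let T (f : C0Section A) (U : Set X) (n : ℕ) : Set (Tot A) :=
    {c | c.proj ∈ U ∧ ‖f.toFun c.proj - c.2‖ < 1 / ((n : ℝ) + 1)}
  have hT : ∀ f U n, IsOpen U → IsOpen (T f U n) := fun f U n hU => by
    refine (hU.preimage hA.continuous_proj).inter (isOpen_iff_mem_nhds.2 fun c hc => ?_)
    obtain ⟨W, hW, W', hW', h⟩ := hA.exists_nhds_norm_sub_lt (b := f.toFun c.proj) (c := c.2) hc
    filter_upwards [hW', hA.eventually_proj c.2 (f.continuous_toFun.continuousAt hW)] with d hd hd'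
    exact h _ _ d.2 hd' hd
  let 𝓑 : Set (Set (Tot A)) := ⋃ f ∈ S, ⋃ U ∈ TopologicalSpace.countableBasis X, ⋃ n : ℕ, {T f U n}
  have hmem : ∀ {f U n}, f ∈ S → U ∈ TopologicalSpace.countableBasis X → T f U n ∈ 𝓑 :=
    fun {f U n} hf hU => Set.mem_biUnion hf (Set.mem_biUnion hU (Set.mem_iUnion.2 ⟨n, rfl⟩))
  have hb : TopologicalSpace.IsTopologicalBasis 𝓑 := by
    refine TopologicalSpace.isTopologicalBasis_of_isOpen_of_nhds ?_ ?_
    · intro B hB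
      simp only [𝓑, Set.mem_iUnion, Set.mem_singleton_iff] at hB
      obtain ⟨f, -, U, hU, n, rfl⟩ := hB
      exact hT f U n (TopologicalSpace.isOpen_of_mem_countableBasis hU)
    · rintro ⟨x, b⟩ W hbW hW
      obtain ⟨U, hU, ε, hε, hUε⟩ := hA.exists_nhds_thickening (hW.mem_nhds hbW)
      obtain ⟨n, hn⟩ := exists_nat_one_div_lt (half_pos hε)
      have hn0 : (0 : ℝ) < 1 / ((n : ℝ) + 1) := Nat.one_div_pos_of_nat
      obtain ⟨f₀, hf₀⟩ := hA.exists_c0Section_near b (half_pos hn0)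
      -- The errors one half and one quarter of the tube radius leave `b` strictly inside the tube
      -- around `f`.
      obtain ⟨f, hfS, hf⟩ := hS f₀ (1 / ((n : ℝ) + 1) / 4) (by positivity)
      have hfb : ‖f.toFun x - b‖ < 1 / ((n : ℝ) + 1) := by
        have h1 := norm_sub_le_norm_sub_add_norm_sub (f.toFun x) (f₀.toFun x) b
        have h2 := hf x
        rw [norm_sub_rev] at h2
        linarith
      have hU' : T f Set.univ n ∈ 𝓝 (⟨x, b⟩ : Tot A) :=
        (hT f _ n isOpen_univ).mem_nhds ⟨trivial, hfb⟩
      obtain ⟨N, hN, hxN, hNU⟩ := (TopologicalSpace.isBasis_countableBasis X).mem_nhds_iff.1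
        (hA.eventually_exists_mem (inter_mem hU hU'))
      refine ⟨T f N n, hmem hfS hN, ⟨hxN, hfb⟩, ?_⟩
      rintro ⟨y, d⟩ ⟨hy, hd⟩
      -- Two vectors of the tube in one fibre are less than `2 / (n + 1) < ε` apart, so a single `c`
      -- of the tube in `U` brings every `d` of the tube over `y` into `W`.
      obtain ⟨c, hcU, -, hc⟩ := hNU hy
      refine hUε y c d hcU ?_
      have h1 := norm_sub_le_norm_sub_add_norm_sub d (f.toFun y) c
      have h2 : ‖f.toFun y - d‖ < 1 / ((n : ℝ) + 1) := hd
      have h3 : ‖f.toFun y - c‖ < 1 / ((n : ℝ) + 1) := hc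
      rw [norm_sub_rev] at h2
      linarith
  refine hb.secondCountableTopology ?_
  refine hSc.biUnion fun f _ => (TopologicalSpace.countable_countableBasis X).biUnion fun U _ =>
    Set.countable_iUnion fun n => Set.countable_singleton _

/-- If the total space is second countable then the section algebra is separable. -/
theorem separable_of_secondCountable [SigmaCompactSpace X] [WeaklyLocallyCompactSpace X]
    (hA : IsUSCCStarBundle A)
    [SecondCountableTopology (Tot A)] : HasSeparableSections A := by
  classical
  let K := CompactExhaustion.choice X
  -- A section is recorded by finite data: finitely many basic open sets containing its values over
  -- a compact set, and a bound on its norm outside. There are countably many such data, and one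
  -- section realising each of them, where there is one, suffices.
  let P (m n : ℕ) (I : Finset (TopologicalSpace.countableBasis (Tot A))) (f : C0Section A) : Prop :=
    (∀ x ∈ K m, (⟨x, f.toFun x⟩ : Tot A) ∈ ⋃ O ∈ I, (O : Set (Tot A))) ∧
      ∀ x ∉ K m, ‖f.toFun x‖ ≤ 1 / ((n : ℝ) + 1)
  let J := ℕ × ℕ × Finset (TopologicalSpace.countableBasis (Tot A))
  let S : Set (C0Section A) :=
    ⋃ j : J, {f | ∃ h : ∃ f, P j.1 j.2.1 j.2.2 f, f = h.choose}
  have : Countable (TopologicalSpace.countableBasis (Tot A)) :=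
    (TopologicalSpace.countable_countableBasis (Tot A)).to_subtype
  refine ⟨S, Set.countable_iUnion fun j => ?_, fun f ε hε => ?_⟩
  · refine Set.Subsingleton.countable ?_
    -- The chosen section depends only on the data, since two proofs of existence are equal.
    rintro f ⟨h, rfl⟩ g ⟨h', rfl⟩
    rfl
  · obtain ⟨n, hn⟩ := exists_nat_one_div_lt (half_pos hε)
    obtain ⟨C, hC, hCf⟩ : ∃ C : Set X, IsCompact C ∧
        ∀ x ∉ C, ‖f.toFun x‖ ≤ 1 / ((n : ℝ) + 1) := by
      have := f.vanishes.eventually (gt_mem_nhds (Nat.one_div_pos_of_nat (n := n)))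
      obtain ⟨C, hC, h⟩ := mem_cocompact.1 this
      exact ⟨C, hC, fun x hx => le_of_lt (h hx)⟩
    obtain ⟨m, hm⟩ := K.exists_superset_of_isCompact hC
    -- Basic sets are taken inside this tube, so any section whose values over `K m` lie in their
    -- union is within `ε` of `f` there.
    let W : Set (Tot A) := {c | ‖f.toFun c.proj - c.2‖ < ε}
    have hW : IsOpen W := isOpen_iff_mem_nhds.2 fun c hc => by
      obtain ⟨O, hO, O', hO', h⟩ := hA.exists_nhds_norm_sub_lt (b := f.toFun c.proj) (c := c.2) hc
      filter_upwards [hO', hA.eventually_proj c.2 (f.continuous_toFun.continuousAt hO)]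
        with d hd hd'
      exact h _ _ d.2 hd' hd
    have hex : ∃ I : Finset (TopologicalSpace.countableBasis (Tot A)),
        (∀ x ∈ K m, (⟨x, f.toFun x⟩ : Tot A) ∈ ⋃ O ∈ I, (O : Set (Tot A))) ∧
          ∀ O ∈ I, (O : Set (Tot A)) ⊆ W := by
      have hcomp : IsCompact ((fun x => (⟨x, f.toFun x⟩ : Tot A)) '' K m) :=
        (K.isCompact m).image f.continuous_toFun
      obtain ⟨t, ht⟩ := hcomp.elim_finite_subcover
        (fun O : {O : TopologicalSpace.countableBasis (Tot A) // (O : Set (Tot A)) ⊆ W} =>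
          (O.1.1 : Set (Tot A)))
        (fun O => TopologicalSpace.isOpen_of_mem_countableBasis O.1.2) (by
          rintro _ ⟨x, -, rfl⟩
          obtain ⟨O, hO, hxO, hOW⟩ :=
            (TopologicalSpace.isBasis_countableBasis (Tot A)).exists_subset_of_mem_open
              (show (⟨x, f.toFun x⟩ : Tot A) ∈ W by simpa [W] using hε) hW
          exact Set.mem_iUnion.2 ⟨⟨⟨O, hO⟩, hOW⟩, hxO⟩)
      refine ⟨t.image Subtype.val, fun x hx => ?_, fun O hO => ?_⟩
      · have := ht ⟨x, hx, rfl⟩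
        simp only [Set.mem_iUnion] at this ⊢
        obtain ⟨O, hO, hxO⟩ := this
        exact ⟨O.1, Finset.mem_image_of_mem _ hO, hxO⟩
      · obtain ⟨O', -, rfl⟩ := Finset.mem_image.1 hO
        exact O'.2
    obtain ⟨I, hI, hIW⟩ := hex
    have hP : ∃ g, P m n I g := ⟨f, hI, fun x hx => hCf x fun h => hx (hm h)⟩
    refine ⟨hP.choose, Set.mem_iUnion.2 ⟨(m, n, I), hP, rfl⟩, fun x => ?_⟩
    obtain ⟨h1, h2⟩ := hP.choose_spec
    by_cases hx : x ∈ K m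
    · obtain ⟨O, hO, hxO⟩ := Set.mem_iUnion₂.1 (h1 x hx)
      exact le_of_lt (hIW O hO hxO)
    · have h3 := h2 x hx
      have h4 := hCf x fun h => hx (hm h)
      have := norm_sub_le (f.toFun x) (hP.choose.toFun x)
      linarith

end IsUSCCStarBundle

end sections

/-! ### Topology of the linking groupoid -/

section topology

theorem isOpenMap_fst_pullback {X Y B : Type*} [TopologicalSpace X] [TopologicalSpace Y]
    [TopologicalSpace B] {f : X → B} {g : Y → B} (hf : Continuous f) (hg : IsOpenMap g) :
    IsOpenMap fun p : {p : X × Y // f p.1 = g p.2} => p.1.1 := by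
  refine IsOpenMap.of_nhds_le ?_
  rintro ⟨⟨x, y⟩, hxy⟩ U hU
  rw [mem_map, nhds_subtype_eq_comap, mem_comap] at hU
  obtain ⟨t, ht, htU⟩ := hU
  obtain ⟨V, hV, W, hW, hVW⟩ := mem_nhds_prod_iff.1 ht
  have h1 : g '' W ∈ 𝓝 (f x) := by
    rw [show f x = g y from hxy]
    exact hg.image_mem_nhds hW
  filter_upwards [hV, hf.continuousAt h1] with x' hx' hx''
  obtain ⟨y', hy', e⟩ := hx''
  exact htU (a := ⟨(x', y'), e.symm⟩) (hVW ⟨hx', hy'⟩)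

/-- The restriction of a continuous open map to the preimage of a set is still open onto that set,
so it carries neighbourhood filters to neighbourhood filters. Partial operations on composable pairs
can then be tested on products of open embeddings and of open quotient maps. -/
theorem continuousAt_subtype_of_comp {Y D W : Type*} [TopologicalSpace Y] [TopologicalSpace D]
    [TopologicalSpace W] {P : D → Prop} {κ : Y → D} (hκ : IsOpenMap κ) (hc : Continuous κ)
    {F : {d // P d} → W} (hF : Continuous fun y : {y // P (κ y)} => F ⟨κ y.1, y.2⟩) (y : Y)
    (hy : P (κ y)) : ContinuousAt F ⟨κ y, hy⟩ := by
  have h1 := (hκ.restrictPreimage {d | P d}).map_nhds_eq (x := ⟨y, hy⟩)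
    (hc.restrictPreimage (s := {d | P d})).continuousAt
  have h2 : ContinuousAt (fun y : {y // P (κ y)} => F ⟨κ y.1, y.2⟩) ⟨y, hy⟩ := hF.continuousAt
  change Tendsto F (𝓝 (Set.restrictPreimage {d | P d} κ ⟨y, hy⟩)) _
  rw [← h1]
  exact tendsto_map'_iff.2 h2

theorem locallyCompactSpace_sum {X Y : Type*} [TopologicalSpace X] [TopologicalSpace Y]
    [LocallyCompactSpace X] [LocallyCompactSpace Y] : LocallyCompactSpace (X ⊕ Y) := by
  refine ⟨?_⟩
  rintro (x | y) n hn
  · obtain ⟨K, hK, hKn, hKc⟩ := local_compact_nhds (continuous_inl.continuousAt hn)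
    exact ⟨_, isOpenMap_inl.image_mem_nhds hK, Set.image_subset_iff.2 hKn,
      hKc.image continuous_inl⟩
  · obtain ⟨K, hK, hKn, hKc⟩ := local_compact_nhds (continuous_inr.continuousAt hn)
    exact ⟨_, isOpenMap_inr.image_mem_nhds hK, Set.image_subset_iff.2 hKn,
      hKc.image continuous_inr⟩

end topology

/-! ### Topology inherited by the unit space -/

section units

variable {G : Type uG} {G₀ : Type uG0} [TopologicalSpace G] [TopologicalSpace G₀] {Γ : Gpd G G₀}

namespace Gpd.IsLCH

/-- The range map is a continuous left inverse, and the units are the equaliser of `unit ∘ r` and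
the identity in a Hausdorff space. -/
theorem isClosedEmbedding_unit (hΓ : Γ.IsLCH) : IsClosedEmbedding Γ.unit := by
  have := hΓ.hausdorff
  have hl : Function.LeftInverse Γ.r Γ.unit := Γ.r_unit
  refine ⟨IsEmbedding.of_leftInverse hl hΓ.continuous_r hΓ.continuous_unit, ?_⟩
  have : Set.range Γ.unit = {x | Γ.unit (Γ.r x) = x} := by
    ext x
    constructor
    · rintro ⟨u, rfl⟩
      exact congrArg Γ.unit (Γ.r_unit u)
    · exact fun h => ⟨_, h⟩
  rw [this]
  exact isClosed_eq (hΓ.continuous_unit.comp hΓ.continuous_r) continuous_id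

theorem t2Space_units (hΓ : Γ.IsLCH) : T2Space G₀ :=
  have := hΓ.hausdorff
  hΓ.isClosedEmbedding_unit.isEmbedding.t2Space

theorem locallyCompactSpace_units (hΓ : Γ.IsLCH) : LocallyCompactSpace G₀ :=
  have := hΓ.locallyCompact
  hΓ.isClosedEmbedding_unit.locallyCompactSpace

theorem secondCountableTopology_units (hΓ : Γ.IsLCH) : SecondCountableTopology G₀ :=
  have := hΓ.secondCountable
  hΓ.isClosedEmbedding_unit.isEmbedding.secondCountableTopology

end Gpd.IsLCH

end units

/-! ### Continuity of division in `Z` and of the operations of `L` -/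

section linking

variable {G : Type uG} {G₀ : Type uG0} {H : Type uH} {H₀ : Type uH0}
  [TopologicalSpace G] [TopologicalSpace G₀] {Γ : Gpd G G₀}
  [TopologicalSpace H] [TopologicalSpace H₀] {Δ : Gpd H H₀} {Z : Type uZ} [TopologicalSpace Z]

namespace GpdEquivalence

variable (E : GpdEquivalence Γ Δ Z)

/-- Freeness makes `(z, η) ↦ (z, z · η)` injective and properness makes it closed. Division is the
second component of its inverse on the image, hence continuous. -/
theorem continuous_rbr : Continuous
    fun p : {p : Z × Z // E.left.anchor p.1 = E.left.anchor p.2} => E.rbr p.1.1 p.1.2 p.2 := by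
  have hcl : IsClosedEmbedding fun p : {p : Z × H // E.right.anchor p.1 = Δ.r p.2} =>
      ((p.1.1, E.right.smul p.1.1 p.1.2 p.2) : Z × Z) := by
    refine .of_continuous_injective_isClosedMap E.right_principal.proper.continuous ?_
      E.right_principal.proper.isClosedMap
    rintro ⟨⟨z, η⟩, h⟩ ⟨⟨w, θ⟩, h'⟩ e
    obtain rfl : z = w := congrArg Prod.fst e
    obtain rfl : η = θ :=
      E.right.eq_of_smul_eq E.right_principal h h' (congrArg Prod.snd e)
    rfl
  have : Continuous fun p : {p : Z × Z // E.left.anchor p.1 = E.left.anchor p.2} =>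
      (⟨(p.1.1, E.rbr p.1.1 p.1.2 p.2), E.r_rbr _ _ p.2⟩ :
        {p : Z × H // E.right.anchor p.1 = Δ.r p.2}) := by
    rw [hcl.isEmbedding.continuous_iff]
    refine continuous_subtype_val.congr fun p => ?_
    exact Prod.ext rfl (E.smul_rbr _ _ p.2).symm
  exact continuous_snd.comp (continuous_subtype_val.comp this)

theorem continuous_lbr : Continuous
    fun p : {p : Z × Z // E.right.anchor p.1 = E.right.anchor p.2} => E.lbr p.1.1 p.1.2 p.2 := by
  have hcl : IsClosedEmbedding fun p : {p : G × Z // Γ.s p.1 = E.left.anchor p.2} =>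
      ((E.left.smul p.1.1 p.1.2 p.2, p.1.2) : Z × Z) := by
    refine .of_continuous_injective_isClosedMap E.left_principal.proper.continuous ?_
      E.left_principal.proper.isClosedMap
    rintro ⟨⟨γ, z⟩, h⟩ ⟨⟨γ', w⟩, h'⟩ e
    obtain rfl : z = w := congrArg Prod.snd e
    obtain rfl : γ = γ' :=
      E.left.eq_of_smul_eq E.left_principal h h' (congrArg Prod.fst e)
    rfl
  have : Continuous fun p : {p : Z × Z // E.right.anchor p.1 = E.right.anchor p.2} =>
      (⟨(E.lbr p.1.1 p.1.2 p.2, p.1.2), E.s_lbr _ _ p.2⟩ :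
        {p : G × Z // Γ.s p.1 = E.left.anchor p.2}) := by
    rw [hcl.isEmbedding.continuous_iff]
    refine continuous_subtype_val.congr fun p => ?_
    exact Prod.ext (E.lbr_smul _ _ p.2).symm rfl
  exact continuous_fst.comp (continuous_subtype_val.comp this)

/-- The range map of the groupoid acting on the right of an equivalence is open. -/
theorem isOpenMap_r (E : GpdEquivalence Γ Δ Z) : IsOpenMap Δ.r := by
  intro V hV
  have h1 : IsOpenMap fun p : {p : Z × Z // E.left.anchor p.1 = E.left.anchor p.2} => p.1.1 :=
    isOpenMap_fst_pullback E.left.continuous_anchor E.left.isOpenMap_anchor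
  -- The image of `V` under the range map is obtained from the open set of pairs `(z, w)` with `[z,
  -- w]_H ∈ V` by projecting to `z` and applying `s_Z`; both maps are open.
  have h2 := E.right.isOpenMap_anchor _ (h1 _ (hV.preimage E.continuous_rbr))
  convert h2
  ext v
  constructor
  · rintro ⟨η, hη, rfl⟩
    obtain ⟨z, hz⟩ := E.right.surjective_anchor (Δ.r η)
    refine ⟨z, ⟨⟨(z, E.right.smul z η hz), (E.left_anchor_smul z η hz).symm⟩, ?_, rfl⟩, hz⟩
    have : η = E.rbr z (E.right.smul z η hz) (E.left_anchor_smul z η hz).symm :=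
      E.eq_rbr _ hz rfl
    rw [this] at hη
    exact hη
  · rintro ⟨_, ⟨p, hp, rfl⟩, rfl⟩
    exact ⟨_, hp, (E.r_rbr _ _ _).symm⟩

end GpdEquivalence

namespace Link

theorem isOpenEmbedding_ofG : IsOpenEmbedding (ofG : G → Link G Z H) := .inl

theorem isOpenEmbedding_ofZ : IsOpenEmbedding (ofZ : Z → Link G Z H) :=
  IsOpenEmbedding.inr.comp .inl

theorem isOpenEmbedding_ofZop : IsOpenEmbedding (ofZop : Z → Link G Z H) :=
  IsOpenEmbedding.inr.comp (IsOpenEmbedding.inr.comp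
    (IsOpenEmbedding.inl.comp MulOpposite.opHomeomorph.isOpenEmbedding))

theorem isOpenEmbedding_ofH : IsOpenEmbedding (ofH : H → Link G Z H) :=
  IsOpenEmbedding.inr.comp (IsOpenEmbedding.inr.comp .inr)

end Link

namespace GpdEquivalence

variable (E : GpdEquivalence Γ Δ Z)

/-- One block of the multiplication table: between the pieces `i` and `j` the product is a known
partial operation `g` with domain `P`, precomposed with `f`. The map `f` swaps and inverts in the
blocks where `G` or `H` acts on the opposite space and is the identity elsewhere. -/
theorem continuousAt_linkMul {X Y W V : Type*} [TopologicalSpace X] [TopologicalSpace Y]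
    [TopologicalSpace W] [TopologicalSpace V] {i : X → Link G Z H} {j : Y → Link G Z H}
    {k : W → Link G Z H} (hi : IsOpenEmbedding i) (hj : IsOpenEmbedding j) (hk : IsOpenEmbedding k)
    {P : V → Prop} {g : {v // P v} → W} (hg : Continuous g) {f : X × Y → V} (hf : Continuous f)
    (hP : ∀ p : X × Y, E.linkS (i p.1) = E.linkR (j p.2) → P (f p))
    (e : ∀ p h, k (g ⟨f p, hP p h⟩) = E.linkMul (i p.1) (j p.2) h) (x : X) (y : Y)
    (h : E.linkS (i x) = E.linkR (j y)) :
    ContinuousAt (fun p : {p : Link G Z H × Link G Z H // E.linkS p.1 = E.linkR p.2} =>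
      E.linkMul p.1.1 p.1.2 p.2) ⟨(i x, j y), h⟩ := by
  refine continuousAt_subtype_of_comp (κ := Prod.map i j)
    (P := fun p => E.linkS p.1 = E.linkR p.2) (hi.isOpenMap.prodMap hj.isOpenMap)
    (hi.continuous.prodMap hj.continuous) (F := fun p => E.linkMul p.1.1 p.1.2 p.2) ?_ (x, y) h
  exact (hk.continuous.comp (hg.comp ((hf.comp continuous_subtype_val).subtype_mk
    fun p : {p : X × Y // E.linkS (i p.1) = E.linkR (j p.2)} => hP p.1 p.2))).congr
      fun p => e p.1 p.2

theorem continuous_linkMul (hΓ : Γ.IsLCH) (hΔ : Δ.IsLCH) :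
    Continuous fun p : {p : Link G Z H × Link G Z H // E.linkS p.1 = E.linkR p.2} =>
      E.linkMul p.1.1 p.1.2 p.2 := by
  have hmG : Continuous fun p : {p : G × G // Γ.s p.1 = Γ.r p.2} => Γ.mul p.1.1 p.1.2 p.2 :=
    hΓ.continuous_mul
  have hmH : Continuous fun p : {p : H × H // Δ.s p.1 = Δ.r p.2} => Δ.mul p.1.1 p.1.2 p.2 :=
    hΔ.continuous_mul
  refine continuous_iff_continuousAt.2 ?_
  rintro ⟨⟨γ | z | z | η, γ' | w | w | η'⟩, h⟩ <;>
    first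
    | exact (Sum.inl_ne_inr h).elim
    | exact (Sum.inr_ne_inl h).elim
    | skip
  · exact E.continuousAt_linkMul Link.isOpenEmbedding_ofG Link.isOpenEmbedding_ofG
      Link.isOpenEmbedding_ofG hmG continuous_id (fun _ h => Sum.inl.inj h) (fun _ _ => rfl) γ γ' h
  · exact E.continuousAt_linkMul Link.isOpenEmbedding_ofG Link.isOpenEmbedding_ofZ
      Link.isOpenEmbedding_ofZ E.left.continuous_smul continuous_id (fun _ h => Sum.inl.inj h)
      (fun _ _ => rfl) γ w h
  · exact E.continuousAt_linkMul Link.isOpenEmbedding_ofZ Link.isOpenEmbedding_ofZop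
      Link.isOpenEmbedding_ofG E.continuous_lbr continuous_id (fun _ h => Sum.inr.inj h)
      (fun _ _ => rfl) z w.unop h
  · exact E.continuousAt_linkMul Link.isOpenEmbedding_ofZ Link.isOpenEmbedding_ofH
      Link.isOpenEmbedding_ofZ E.right.continuous_smul continuous_id (fun _ h => Sum.inr.inj h)
      (fun _ _ => rfl) z η' h
  · exact E.continuousAt_linkMul Link.isOpenEmbedding_ofZop Link.isOpenEmbedding_ofG
      Link.isOpenEmbedding_ofZop E.left.continuous_smul (f := fun p => (Γ.inv p.2, p.1))
      ((hΓ.continuous_inv.comp continuous_snd).prodMk continuous_fst)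
      (fun _ h => (Γ.s_inv _).trans (Sum.inl.inj h).symm) (fun _ _ => rfl) z.unop γ' h
  · exact E.continuousAt_linkMul Link.isOpenEmbedding_ofZop Link.isOpenEmbedding_ofZ
      Link.isOpenEmbedding_ofH E.continuous_rbr continuous_id (fun _ h => Sum.inl.inj h)
      (fun _ _ => rfl) z.unop w h
  · exact E.continuousAt_linkMul Link.isOpenEmbedding_ofH Link.isOpenEmbedding_ofZop
      Link.isOpenEmbedding_ofZop E.right.continuous_smul (f := fun p => (p.2, Δ.inv p.1))
      (continuous_snd.prodMk (hΔ.continuous_inv.comp continuous_fst))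
      (fun _ h => (Sum.inr.inj h).symm.trans (Δ.r_inv _).symm) (fun _ _ => rfl) η w.unop h
  · exact E.continuousAt_linkMul Link.isOpenEmbedding_ofH Link.isOpenEmbedding_ofH
      Link.isOpenEmbedding_ofH hmH continuous_id (fun _ h => Sum.inr.inj h) (fun _ _ => rfl) η η' h

theorem linking_isLCH [LocallyCompactSpace Z] [T2Space Z] [SecondCountableTopology Z]
    (hΓ : Γ.IsLCH) (hΔ : Δ.IsLCH) : E.linking.IsLCH := by
  have := hΓ.locallyCompact
  have := hΓ.hausdorff
  have := hΓ.secondCountable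
  have := hΔ.locallyCompact
  have := hΔ.hausdorff
  have := hΔ.secondCountable
  have : SecondCountableTopology Zᵐᵒᵖ :=
    MulOpposite.opHomeomorph.symm.isEmbedding.secondCountableTopology
  have h1 : LocallyCompactSpace (Zᵐᵒᵖ ⊕ H) := locallyCompactSpace_sum
  have h2 : LocallyCompactSpace (Z ⊕ Zᵐᵒᵖ ⊕ H) := locallyCompactSpace_sum
  exact
    { locallyCompact := locallyCompactSpace_sum
      hausdorff := inferInstance
      secondCountable := inferInstance
      continuous_r := by
        refine continuous_sum_dom.2 ⟨?_, continuous_sum_dom.2 ⟨?_, continuous_sum_dom.2 ⟨?_, ?_⟩⟩⟩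
        · exact continuous_inl.comp hΓ.continuous_r
        · exact continuous_inl.comp E.left.continuous_anchor
        · exact continuous_inr.comp (E.right.continuous_anchor.comp MulOpposite.continuous_unop)
        · exact continuous_inr.comp hΔ.continuous_r
      continuous_s := by
        refine continuous_sum_dom.2 ⟨?_, continuous_sum_dom.2 ⟨?_, continuous_sum_dom.2 ⟨?_, ?_⟩⟩⟩
        · exact continuous_inl.comp hΓ.continuous_s
        · exact continuous_inr.comp E.right.continuous_anchor
        · exact continuous_inl.comp (E.left.continuous_anchor.comp MulOpposite.continuous_unop)
        · exact continuous_inr.comp hΔ.continuous_s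
      continuous_unit := by
        refine continuous_sum_dom.2 ⟨?_, ?_⟩
        · exact Link.isOpenEmbedding_ofG.continuous.comp hΓ.continuous_unit
        · exact Link.isOpenEmbedding_ofH.continuous.comp hΔ.continuous_unit
      continuous_mul := E.continuous_linkMul hΓ hΔ
      continuous_inv := by
        refine continuous_sum_dom.2 ⟨?_, continuous_sum_dom.2 ⟨?_, continuous_sum_dom.2 ⟨?_, ?_⟩⟩⟩
        · exact Link.isOpenEmbedding_ofG.continuous.comp hΓ.continuous_inv
        · exact Link.isOpenEmbedding_ofZop.continuous
        · exact Link.isOpenEmbedding_ofZ.continuous.comp MulOpposite.continuous_unop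
        · exact Link.isOpenEmbedding_ofH.continuous.comp hΔ.continuous_inv }

end GpdEquivalence

end linking

/-! ### The bundle over the units of the linking groupoid -/

section castIso

variable {X : Type uX} {A : X → Type uA} [∀ x, NonUnitalCStarAlgebra (A x)]

/-- The identification of the fibres over equal points. -/
def castIso {x y : X} (h : x = y) : A x ≃⋆ₐ[ℂ] A y := by
  subst h
  exact StarAlgEquiv.refl ℂ (A x)

theorem mk_castIso {x y : X} (h : x = y) (a : A x) : (⟨y, castIso h a⟩ : Tot A) = ⟨x, a⟩ := by
  subst h
  rfl

theorem toFiber_mk {x y : X} (h : x = y) (a : A x) :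
    toFiber (⟨x, a⟩ : Tot A) h = castIso h a := by
  subst h
  rfl

end castIso

namespace BundleAction

variable {G : Type uG} {G₀ : Type uG0} {A : G₀ → Type uA} [∀ u, NonUnitalCStarAlgebra (A u)]
  [TopologicalSpace G] {Γ : Gpd G G₀} [TopologicalSpace (Tot A)] (α : BundleAction Γ A)

theorem invAct_famAct (γ : G) (a : Tot A) (h : a.proj = Γ.s γ) :
    α.invAct γ (famAct Γ α.iso γ a h) rfl = a :=
  α.famAct_injective γ rfl h (α.famAct_invAct γ _ rfl)

/-- Continuity is part of the data only for `α_γ`; this transfers it to the inverses, which occur in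
the action on the pullback. -/
theorem invAct_eq_famAct_inv (γ : G) (a : Tot A) (h : a.proj = Γ.r γ) :
    α.invAct γ a h = famAct Γ α.iso (Γ.inv γ) a (h.trans (Γ.s_inv γ).symm) := by
  refine α.famAct_injective γ rfl (Γ.r_inv γ) ?_
  rw [famAct_invAct, ← α.mul_act _ _ (Γ.r_inv γ).symm]
  refine ((α.famAct_congr ?_ rfl _ _).trans (α.famAct_unit a)).symm
  rw [Γ.mul_inv, h]

end BundleAction

/-! ### Representatives and fibres of the induced bundle; openness of the quotient map -/

section induction

variable {G : Type uG} {G₀ : Type uG0} {H : Type uH} {H₀ : Type uH0}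
  [TopologicalSpace G] [TopologicalSpace G₀] {Γ : Gpd G G₀}
  [TopologicalSpace H] [TopologicalSpace H₀] {Δ : Gpd H H₀} {Z : Type uZ} [TopologicalSpace Z]
  {A : H₀ → Type uA} [∀ v, NonUnitalCStarAlgebra (A v)] [TopologicalSpace (Tot A)]
  (E : GpdEquivalence Γ Δ Z) (α : BundleAction Δ A)

theorem IndFiber.mk_eq_mk_smul {u : G₀} (z : Z) (hz : E.left.anchor z = u) (a : Tot A)
    (h : E.right.anchor z = a.proj) (η : H) (hη : E.right.anchor z = Δ.r η) (b : Tot A)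
    (hb : b.proj = Δ.s η) (e : famAct Δ α.iso η b hb = a) :
    IndFiber.mk E α z hz a h = IndFiber.mk E α (E.right.smul z η hη)
      ((E.left_anchor_smul z η hη).trans hz) b ((E.right.anchor_smul z η hη).trans hb.symm) := by
  subst e
  exact Subtype.ext (Quotient.sound (s := pullSetoid E α)
    ⟨η, hη, Subtype.ext (Prod.ext rfl (α.invAct_famAct η b hb))⟩)

theorem IndFiber.mk_congr {u : G₀} {z z' : Z} {a a' : Tot A} (ez : z = z') (ea : a = a')
    (hz : E.left.anchor z = u) (hz' : E.left.anchor z' = u)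
    (h : E.right.anchor z = a.proj) (h' : E.right.anchor z' = a'.proj) :
    IndFiber.mk E α z hz a h = IndFiber.mk E α z' hz' a' h' := by
  subst ez ea; rfl

/-- Change of representative: since `w = z · [z, w]_H`, every class over `u` has a representative at
any prescribed point `z` over `u`. -/
theorem IndFiber.mk_rbr {u : G₀} (z w : Z) (hz : E.left.anchor z = u) (hw : E.left.anchor w = u)
    (b : Tot A) (hb : E.right.anchor w = b.proj) :
    IndFiber.mk E α w hw b hb = IndFiber.mk E α z hz
      (famAct Δ α.iso (E.rbr z w (hz.trans hw.symm)) b (hb.symm.trans (E.s_rbr _ _ _).symm))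
      (E.r_rbr _ _ _) := by
  rw [IndFiber.mk_eq_mk_smul E α z hz _ (E.r_rbr z w (hz.trans hw.symm))
    (E.rbr z w (hz.trans hw.symm)) (E.r_rbr _ _ _) b (hb.symm.trans (E.s_rbr _ _ _).symm) rfl]
  exact IndFiber.mk_congr E α (E.smul_rbr _ _ _).symm rfl _ _ _ _

/-- The defining isomorphism of the fibre `A^Z_u`. -/
def indFiberIso (u : G₀) :
    IndFiber E α u ≃⋆ₐ[ℂ] A (E.right.anchor (basePoint E u)) :=
  { indFiberEquiv E α u with
    map_mul' := fun _ _ => (indFiberEquiv E α u).apply_symm_apply _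
    map_add' := fun _ _ => (indFiberEquiv E α u).apply_symm_apply _
    map_star' := fun _ => (indFiberEquiv E α u).apply_symm_apply _
    map_smul' := fun _ _ => (indFiberEquiv E α u).apply_symm_apply _ }

theorem indFiberIso_symm_apply (u : G₀) (a : A (E.right.anchor (basePoint E u))) :
    (indFiberIso E α u).symm a
      = IndFiber.mk E α (basePoint E u) (anchor_basePoint E u) ⟨_, a⟩ rfl := rfl

/-- The isomorphism `a ↦ [z, a]` onto the fibre over `r_Z(z)`. -/
def fiberIso {u : G₀} {v : H₀} (z : Z) (hz : E.left.anchor z = u) (hv : E.right.anchor z = v) :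
    A v ≃⋆ₐ[ℂ] IndFiber E α u :=
  (((castIso (hv.symm.trans (E.s_rbr (basePoint E u) z ((anchor_basePoint E u).trans hz.symm)).symm)
    ).trans (α.iso (E.rbr (basePoint E u) z ((anchor_basePoint E u).trans hz.symm)))).trans
    (castIso (E.r_rbr (basePoint E u) z ((anchor_basePoint E u).trans hz.symm)).symm)).trans
    (indFiberIso E α u).symm

/-- The algebra structure on the fibre was transported from one chosen base point. Changing to
another `z` composes with the isomorphism `α` of an arrow, so the structure does not depend on that
choice. -/
theorem fiberIso_apply {u : G₀} {v : H₀} (z : Z) (hz : E.left.anchor z = u)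
    (hv : E.right.anchor z = v) (a : A v) :
    fiberIso E α z hz hv a = IndFiber.mk E α z hz ⟨v, a⟩ hv := by
  have h := (anchor_basePoint E u).trans hz.symm
  rw [IndFiber.mk_rbr E α (basePoint E u) z (anchor_basePoint E u) hz ⟨v, a⟩ hv]
  refine (indFiberIso_symm_apply E α u _).trans ?_
  refine IndFiber.mk_congr E α rfl ?_ _ _ _ _
  refine (mk_castIso _ _).trans ?_
  exact congrArg (Bundle.TotalSpace.mk _) (congrArg _ (toFiber_mk _ a).symm)

theorem norm_indFiber_mk {u : G₀} (z : Z) (hz : E.left.anchor z = u) (a : Tot A)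
    (h : E.right.anchor z = a.proj) : ‖IndFiber.mk E α z hz a h‖ = ‖a.2‖ := by
  rw [← fiberIso_apply E α z hz h a.2]
  exact StarAlgEquiv.norm_map (fiberIso E α z hz h) a.2

theorem continuous_pullAct (hΔ : Δ.IsLCH) : Continuous
    fun p : {p : Pullback E A × H // E.right.anchor p.1.1.1 = Δ.r p.2} =>
      pullAct E α p.1.1 p.1.2 p.2 := by
  have hx : Continuous fun x : Pullback E A => (x.1 : Z × Tot A) := continuous_subtype_val
  have h1 : Continuous fun p : {p : Pullback E A × H // E.right.anchor p.1.1.1 = Δ.r p.2} =>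
      E.right.smul p.1.1.1.1 p.1.2 p.2 :=
    E.right.continuous_smul.comp (Continuous.subtype_mk (f := fun p :
      {p : Pullback E A × H // E.right.anchor p.1.1.1 = Δ.r p.2} => (p.1.1.1.1, p.1.2))
      (by fun_prop) fun p => p.2)
  have h2 : Continuous fun p : {p : Pullback E A × H // E.right.anchor p.1.1.1 = Δ.r p.2} =>
      α.invAct p.1.2 p.1.1.1.2 (p.1.1.2.symm.trans p.2) := by
    simp only [α.invAct_eq_famAct_inv]
    have := hΔ.continuous_inv
    exact α.continuous_act.comp (Continuous.subtype_mk (f := fun p :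
      {p : Pullback E A × H // E.right.anchor p.1.1.1 = Δ.r p.2} =>
        (Δ.inv p.1.2, p.1.1.1.2)) (by fun_prop)
      fun p => (p.1.1.2.symm.trans p.2).trans (Δ.s_inv _).symm)
  exact (h1.prodMk h2).subtype_mk _

theorem isOpenMap_quotient (hΔ : Δ.IsLCH) :
    IsOpenMap (Quotient.mk (pullSetoid E α) : Pullback E A → IndSpace E α) := by
  intro U hU
  have hx : Continuous fun x : Pullback E A => E.right.anchor x.1.1 :=
    E.right.continuous_anchor.comp (continuous_fst.comp continuous_subtype_val)
  -- The saturation of `U` is the projection of the open set of pairs `(y, η)` with `y · η ∈ U`;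
  -- that projection is open because the range map of `H` is.
  have h := isOpenMap_fst_pullback hx E.isOpenMap_r _
    (hU.preimage (continuous_pullAct E α hΔ))
  change IsOpen (Quotient.mk (pullSetoid E α) ⁻¹' (Quotient.mk (pullSetoid E α) '' U))
  convert h
  ext y
  constructor
  · rintro ⟨x, hx, e⟩
    obtain ⟨η, hη, e'⟩ := Quotient.exact (s := pullSetoid E α) e.symm
    refine ⟨⟨(y, η), hη⟩, ?_, rfl⟩
    change pullAct E α y η hη ∈ U
    rwa [e']
  · rintro ⟨⟨⟨x, η⟩, hη⟩, hp, rfl⟩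
    exact ⟨_, hp, (Quotient.sound (s := pullSetoid E α) ⟨η, hη, rfl⟩).symm⟩

end induction

/-! ### The bundle `B`: continuity of its operations, and separability -/

section linkBundle

variable {G : Type uG} {G₀ : Type uG0} {H : Type uH}
  [TopologicalSpace G] [TopologicalSpace G₀] {Γ : Gpd G G₀}
  [TopologicalSpace H] {H₀ : Type u} [TopologicalSpace H₀] {Δ : Gpd H H₀}
  {Z : Type u} [TopologicalSpace Z]
  {A : H₀ → Type u} [∀ v, NonUnitalCStarAlgebra (A v)] [TopologicalSpace (Tot A)]
  (E : GpdEquivalence Γ Δ Z) (α : BundleAction Δ A)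

namespace LinkBundle

/-- The class `[z, a]` as a point of the total space of the bundle `B`. -/
def cls (x : Pullback E A) : Tot (LinkBundle E α) :=
  ⟨.inl (E.left.anchor x.1.1), IndFiber.mk E α x.1.1 rfl x.1.2 x.2⟩

/-- The inclusion of the total space of `A`. -/
def incl (a : Tot A) : Tot (LinkBundle E α) := ⟨.inr a.proj, a.2⟩

theorem mk_inl_eq_cls {u : G₀} (z : Z) (hz : E.left.anchor z = u) (a : Tot A)
    (h : E.right.anchor z = a.proj) :
    (⟨.inl u, IndFiber.mk E α z hz a h⟩ : Tot (LinkBundle E α)) = cls E α ⟨(z, a), h⟩ := by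
  subst hz; rfl

theorem cls_rbr (z : Z) (x : Pullback E A) (h : E.left.anchor z = E.left.anchor x.1.1) :
    cls E α x = cls E α ⟨(z, famAct Δ α.iso (E.rbr z x.1.1 h) x.1.2
      (x.2.symm.trans (E.s_rbr _ _ _).symm)), E.r_rbr _ _ _⟩ := by
  exact (congrArg (Bundle.TotalSpace.mk (Sum.inl (E.left.anchor x.1.1)))
    (IndFiber.mk_rbr E α z x.1.1 h rfl x.1.2 x.2)).trans
    (mk_inl_eq_cls E α z h _ _)

theorem exists_mk {u : G₀} (q : IndFiber E α u) : ∃ (z : Z) (hz : E.left.anchor z = u) (a : Tot A)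
    (h : E.right.anchor z = a.proj), IndFiber.mk E α z hz a h = q := by
  obtain ⟨q, hq⟩ := q
  obtain ⟨x, rfl⟩ := Quotient.exists_rep q
  exact ⟨x.1.1, hq, x.1.2, x.2, rfl⟩

theorem exists_rep (b : Tot (LinkBundle E α)) :
    (∃ x, cls E α x = b) ∨ ∃ a, incl E α a = b := by
  obtain ⟨u | v, b⟩ := b
  · obtain ⟨z, hz, a, h, rfl⟩ := exists_mk E α b
    exact .inl ⟨_, (mk_inl_eq_cls E α z hz a h).symm⟩
  · exact .inr ⟨⟨v, b⟩, rfl⟩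

/-- The total space of `B` is the disjoint union of the spaces `A^Z` and `A`. -/
def homeoSum : Tot (LinkBundle E α) ≃ₜ IndSpace E α ⊕ Tot A :=
  Equiv.toHomeomorphOfIsInducing
    { toFun := toSum E α
      invFun := Sum.elim (fun q => ⟨.inl (IndSpace.proj E α q), ⟨q, rfl⟩⟩) (incl E α)
      left_inv := by
        rintro ⟨u | v, b⟩
        · obtain ⟨q, rfl⟩ := b
          rfl
        · rfl
      right_inv := by
        rintro (q | a) <;> rfl } ⟨rfl⟩

theorem isOpenEmbedding_incl : IsOpenEmbedding (incl E α) :=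
  (homeoSum E α).symm.isOpenEmbedding.comp IsOpenEmbedding.inr

theorem continuous_cls : Continuous (cls E α) :=
  (homeoSum E α).symm.continuous.comp (continuous_inl.comp continuous_quotient_mk')

theorem isOpenMap_cls (hΔ : Δ.IsLCH) : IsOpenMap (cls E α) :=
  (homeoSum E α).symm.isOpenMap.comp (isOpenMap_inl.comp (isOpenMap_quotient E α hΔ))

theorem map_cls_nhds (hΔ : Δ.IsLCH) (x : Pullback E A) :
    map (cls E α) (𝓝 x) = 𝓝 (cls E α x) :=
  (isOpenMap_cls E α hΔ).map_nhds_eq (continuous_cls E α).continuousAt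

theorem map_incl_nhds (a : Tot A) : map (incl E α) (𝓝 a) = 𝓝 (incl E α a) :=
  (isOpenEmbedding_incl E α).map_nhds_eq a

/-- The maps `cls` and `incl` are continuous, open and jointly surjective. -/
theorem continuous_of_comp (hΔ : Δ.IsLCH) {W : Type*} [TopologicalSpace W]
    {F : Tot (LinkBundle E α) → W} (h1 : Continuous fun x => F (cls E α x))
    (h2 : Continuous fun a => F (incl E α a)) : Continuous F := by
  refine continuous_iff_continuousAt.2 fun b => ?_
  obtain ⟨x, rfl⟩ | ⟨a, rfl⟩ := exists_rep E α b
  · rw [ContinuousAt, ← map_cls_nhds E α hΔ]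
    exact tendsto_map'_iff.2 h1.continuousAt
  · rw [ContinuousAt, ← map_incl_nhds E α]
    exact tendsto_map'_iff.2 h2.continuousAt

theorem norm_cls (x : Pullback E A) : ‖(cls E α x).2‖ = ‖x.1.2.2‖ :=
  norm_indFiber_mk E α x.1.1 rfl x.1.2 x.2

theorem secondCountableTopology [SecondCountableTopology Z] [SecondCountableTopology (Tot A)]
    (hΔ : Δ.IsLCH) : SecondCountableTopology (Tot (LinkBundle E α)) := by
  have : SecondCountableTopology (Pullback E A) :=
    TopologicalSpace.Subtype.secondCountableTopology {x : Z × Tot A | E.right.anchor x.1 = x.2.proj}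
  have : SecondCountableTopology (IndSpace E α) :=
    (isQuotientMap_quotient_mk' (s := pullSetoid E α)).secondCountableTopology
      (isOpenMap_quotient E α hΔ)
  exact (homeoSum E α).isEmbedding.secondCountableTopology

theorem continuous_unop (hΔ : Δ.IsLCH) (m : ∀ v, A v → A v)
    (m' : ∀ w, LinkBundle E α w → LinkBundle E α w)
    (hm : Continuous fun a : Tot A => (⟨a.proj, m _ a.2⟩ : Tot A))
    (h1 : ∀ z (a : A (E.right.anchor z)), m' (.inl (E.left.anchor z))
      (IndFiber.mk E α z rfl ⟨_, a⟩ rfl) = IndFiber.mk E α z rfl ⟨_, m _ a⟩ rfl)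
    (h2 : ∀ v (a : A v), m' (.inr v) a = m v a) :
    Continuous fun b : Tot (LinkBundle E α) => (⟨b.proj, m' _ b.2⟩ : Tot (LinkBundle E α)) := by
  refine continuous_of_comp E α hΔ ?_ ?_
  · have hc : Continuous fun x : Pullback E A =>
        (⟨(x.1.1, ⟨x.1.2.proj, m _ x.1.2.2⟩), x.2⟩ : Pullback E A) :=
      ((continuous_fst.comp continuous_subtype_val).prodMk
        (hm.comp (continuous_snd.comp continuous_subtype_val))).subtype_mk _
    refine ((continuous_cls E α).comp hc).congr ?_
    rintro ⟨⟨z, v, a⟩, h⟩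
    change E.right.anchor z = v at h
    subst h
    exact congrArg (Bundle.TotalSpace.mk _) (h1 z a).symm
  · refine ((isOpenEmbedding_incl E α).continuous.comp hm).congr fun a => ?_
    exact congrArg (Bundle.TotalSpace.mk _) (h2 _ a.2).symm

/-- Two classes over one unit usually come with different points `z` and `w`. The second is first
moved over `z` by the arrow `[z, w]_H`, which is continuous in the pair, and then `m` acts in one
fibre of `A`. -/
theorem continuous_binop (hΔ : Δ.IsLCH) (m : ∀ v, A v → A v → A v)
    (m' : ∀ w, LinkBundle E α w → LinkBundle E α w → LinkBundle E α w)
    (hm : Continuous fun p : {p : Tot A × Tot A // p.2.proj = p.1.proj} =>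
      (⟨p.1.1.proj, m _ p.1.1.2 (toFiber p.1.2 p.2)⟩ : Tot A))
    (h1 : ∀ z (a b : A (E.right.anchor z)), m' (.inl (E.left.anchor z))
      (IndFiber.mk E α z rfl ⟨_, a⟩ rfl) (IndFiber.mk E α z rfl ⟨_, b⟩ rfl)
        = IndFiber.mk E α z rfl ⟨_, m _ a b⟩ rfl)
    (h2 : ∀ v (a b : A v), m' (.inr v) a b = m v a b) :
    Continuous fun p : {p : Tot (LinkBundle E α) × Tot (LinkBundle E α) // p.2.proj = p.1.proj} =>
      (⟨p.1.1.proj, m' _ p.1.1.2 (toFiber p.1.2 p.2)⟩ : Tot (LinkBundle E α)) := by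
  -- The point `c` is a variable equal to the class, so that a change of representative can be
  -- substituted without rewriting inside dependent fibres.
  have key : ∀ (z : Z) (a b : Tot A) (ha : E.right.anchor z = a.proj) (hb : b.proj = a.proj)
      (c : Tot (LinkBundle E α)) (_ : c = cls E α ⟨(z, b), ha.trans hb.symm⟩)
      (h : c.proj = (cls E α ⟨(z, a), ha⟩).proj),
      cls E α ⟨(z, ⟨a.proj, m _ a.2 (toFiber b hb)⟩), ha⟩ =
        ⟨_, m' _ (cls E α ⟨(z, a), ha⟩).2 (toFiber c h)⟩ := by
    rintro z ⟨v, a⟩ ⟨w, b⟩ ha hb c rfl h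
    obtain rfl : w = v := hb
    obtain rfl : _ = w := ha
    exact congrArg (Bundle.TotalSpace.mk _) (h1 z a b).symm
  have hl : ∀ p : Pullback E A × Pullback E A, (cls E α p.2).proj = (cls E α p.1).proj →
      E.left.anchor p.1.1.1 = E.left.anchor p.2.1.1 := fun p h => (Sum.inl.inj h).symm
  refine continuous_iff_continuousAt.2 ?_
  rintro ⟨⟨b, c⟩, h⟩
  obtain ⟨x, rfl⟩ | ⟨b, rfl⟩ := exists_rep E α b <;> obtain ⟨y, rfl⟩ | ⟨c, rfl⟩ := exists_rep E α c
  · refine continuousAt_subtype_of_comp (κ := Prod.map (cls E α) (cls E α))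
      (P := fun p => p.2.proj = p.1.proj)
      ((isOpenMap_cls E α hΔ).prodMap (isOpenMap_cls E α hΔ))
      ((continuous_cls E α).prodMap (continuous_cls E α))
      (F := fun p => (⟨p.1.1.proj, m' _ p.1.1.2 (toFiber p.1.2 p.2)⟩ : Tot (LinkBundle E α)))
      ?_ (x, y) h
    let D := {p : Pullback E A × Pullback E A // (cls E α p.2).proj = (cls E α p.1).proj}
    have hx : Continuous fun x : Pullback E A => (x.1 : Z × Tot A) := continuous_subtype_val
    have hr : Continuous fun p : D => E.rbr p.1.1.1.1 p.1.2.1.1 (hl p.1 p.2) :=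
      E.continuous_rbr.comp (Continuous.subtype_mk (f := fun p : D => (p.1.1.1.1, p.1.2.1.1))
        (by fun_prop) fun p => hl p.1 p.2)
    have hb : Continuous fun p : D => famAct Δ α.iso (E.rbr p.1.1.1.1 p.1.2.1.1 (hl p.1 p.2))
        p.1.2.1.2 (p.1.2.2.symm.trans (E.s_rbr _ _ _).symm) :=
      α.continuous_act.comp (Continuous.subtype_mk (f := fun p : D =>
        (E.rbr p.1.1.1.1 p.1.2.1.1 (hl p.1 p.2), p.1.2.1.2)) (by fun_prop)
        fun p => p.1.2.2.symm.trans (E.s_rbr _ _ (hl p.1 p.2)).symm)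
    have hproj : ∀ p : D, (famAct Δ α.iso (E.rbr p.1.1.1.1 p.1.2.1.1 (hl p.1 p.2)) p.1.2.1.2
        (p.1.2.2.symm.trans (E.s_rbr _ _ _).symm)).proj = p.1.1.1.2.proj :=
      fun p => (E.r_rbr _ _ (hl p.1 p.2)).symm.trans p.1.1.2
    have hs := hm.comp (Continuous.subtype_mk (f := fun p : D => (p.1.1.1.2,
        famAct Δ α.iso (E.rbr p.1.1.1.1 p.1.2.1.1 (hl p.1 p.2)) p.1.2.1.2
          (p.1.2.2.symm.trans (E.s_rbr _ _ _).symm))) (by fun_prop) hproj)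
    have hz : Continuous fun p : D => p.1.1.1.1 := by fun_prop
    refine ((continuous_cls E α).comp
      ((hz.prodMk hs).subtype_mk fun p => p.1.1.2)).congr fun p => ?_
    exact key p.1.1.1.1 p.1.1.1.2 _ p.1.1.2 (hproj p) (cls E α p.1.2)
      (cls_rbr E α p.1.1.1.1 p.1.2 (hl p.1 p.2)) p.2
  · exact (Sum.inr_ne_inl h).elim
  · exact (Sum.inl_ne_inr h).elim
  · refine continuousAt_subtype_of_comp (κ := Prod.map (incl E α) (incl E α))
      (P := fun p => p.2.proj = p.1.proj)
      ((isOpenEmbedding_incl E α).isOpenMap.prodMap (isOpenEmbedding_incl E α).isOpenMap)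
      ((isOpenEmbedding_incl E α).continuous.prodMap (isOpenEmbedding_incl E α).continuous)
      (F := fun p => (⟨p.1.1.proj, m' _ p.1.1.2 (toFiber p.1.2 p.2)⟩ : Tot (LinkBundle E α)))
      ?_ (b, c) h
    have hi : ∀ p : {p : Tot A × Tot A // (incl E α p.2).proj = (incl E α p.1).proj},
        p.1.2.proj = p.1.1.proj := fun p => Sum.inr.inj p.2
    refine ((isOpenEmbedding_incl E α).continuous.comp
      (hm.comp (continuous_subtype_val.subtype_mk hi))).congr ?_
    rintro ⟨⟨⟨v, a⟩, ⟨w, b⟩⟩, h⟩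
    obtain rfl : w = v := Sum.inr.inj h
    exact congrArg (Bundle.TotalSpace.mk _) (h2 w a b).symm

theorem isUSCCStarBundle (hΔ : Δ.IsLCH) (hA : IsUSCCStarBundle A) :
    IsUSCCStarBundle (LinkBundle E α) where
  continuous_proj := by
    refine continuous_of_comp E α hΔ ?_ (continuous_inr.comp hA.continuous_proj)
    exact continuous_inl.comp
      (E.left.continuous_anchor.comp (continuous_fst.comp continuous_subtype_val))
  isOpenMap_proj := by
    refine IsOpenMap.of_nhds_le fun b => ?_
    obtain ⟨x, rfl⟩ | ⟨a, rfl⟩ := exists_rep E α b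
    · rw [← map_cls_nhds E α hΔ, map_map]
      have h1 : IsOpenMap fun x : Pullback E A => x.1.1 :=
        isOpenMap_fst_pullback E.right.continuous_anchor hA.isOpenMap_proj
      exact (isOpenMap_inl.comp (E.left.isOpenMap_anchor.comp h1)).nhds_le x
    · rw [← map_incl_nhds E α, map_map]
      exact (isOpenMap_inr.comp hA.isOpenMap_proj).nhds_le a
  usc_norm := by
    intro b y hy
    obtain ⟨x, rfl⟩ | ⟨a, rfl⟩ := exists_rep E α b
    · rw [← map_cls_nhds E α hΔ, eventually_map]
      simp only [norm_cls] at hy ⊢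
      have h1 : ContinuousAt (fun x : Pullback E A => x.1.2) x :=
        (continuous_snd.comp continuous_subtype_val).continuousAt
      exact h1.eventually (hA.usc_norm x.1.2 y hy)
    · rw [← map_incl_nhds E α, eventually_map]
      exact hA.usc_norm a y hy
  continuous_add := by
    refine continuous_binop E α hΔ (fun _ a b => a + b) (fun _ a b => a + b) hA.continuous_add
      (fun z a b => ?_) fun _ _ _ => rfl
    simp only [← fiberIso_apply]
    exact (map_add (fiberIso E α z rfl rfl) a b).symm
  continuous_smul c := by
    refine continuous_unop E α hΔ (fun _ a => c • a) (fun _ a => c • a) (hA.continuous_smul c)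
      (fun z a => ?_) fun _ _ => rfl
    simp only [← fiberIso_apply]
    exact (map_smul (fiberIso E α z rfl rfl) c a).symm
  continuous_mul := by
    refine continuous_binop E α hΔ (fun _ a b => a * b) (fun _ a b => a * b) hA.continuous_mul
      (fun z a b => ?_) fun _ _ _ => rfl
    simp only [← fiberIso_apply]
    exact (map_mul (fiberIso E α z rfl rfl) a b).symm
  continuous_star := by
    refine continuous_unop E α hΔ (fun _ a => star a) (fun _ a => star a) hA.continuous_star
      (fun z a => ?_) fun _ _ => rfl
    simp only [← fiberIso_apply]
    exact (map_star (fiberIso E α z rfl rfl) a).symm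
  zero_nhds := by
    rintro (u | v) W hW
    · obtain ⟨z, hz⟩ := E.left.surjective_anchor u
      have h0 : (⟨.inl u, 0⟩ : Tot (LinkBundle E α)) =
          cls E α ⟨(z, ⟨E.right.anchor z, 0⟩), rfl⟩ := by
        rw [← mk_inl_eq_cls E α z hz, ← fiberIso_apply]
        exact congrArg (Bundle.TotalSpace.mk _) (map_zero (fiberIso E α z hz rfl)).symm
      rw [h0] at hW
      obtain ⟨t, ht, htW⟩ := (mem_nhds_induced Subtype.val _ _).1
        ((continuous_cls E α).continuousAt hW)
      obtain ⟨V, hV, O, hO, hVO⟩ := mem_nhds_prod_iff.1 ht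
      obtain ⟨t', ht', htO⟩ := mem_comap.1 (hA.zero_nhds _ hO)
      obtain ⟨N, hN, R, hR, hNR⟩ := mem_nhds_prod_iff.1 ht'
      have hV' : V ∩ E.right.anchor ⁻¹' N ∈ 𝓝 z :=
        inter_mem hV (E.right.continuous_anchor.continuousAt hN)
      refine mem_comap.2 ⟨(Sum.inl '' (E.left.anchor '' (V ∩ E.right.anchor ⁻¹' N))) ×ˢ R, ?_, ?_⟩
      · refine prod_mem_nhds ?_ hR
        rw [← hz]
        exact isOpenMap_inl.image_mem_nhds (E.left.isOpenMap_anchor.image_mem_nhds hV')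
      · rintro b ⟨hb1, hb2⟩
        obtain ⟨_, ⟨w, ⟨hwV, hwN⟩, rfl⟩, e⟩ := hb1
        obtain ⟨x, rfl⟩ | ⟨a, rfl⟩ := exists_rep E α b
        -- The point is rewritten with the representative `w` in `V ∩ s_Z⁻¹(N)`. Its vector then
        -- lies over `s_Z(w) ∈ N` and has the same norm, so it lies in `O`.
        · have hx := cls_rbr E α w x (Sum.inl.inj e)
          rw [hx] at hb2 ⊢
          refine htW (hVO ⟨hwV, htO (hNR ⟨?_, ?_⟩)⟩)
          · exact (congrArg (· ∈ N) (E.r_rbr w x.1.1 (Sum.inl.inj e))).mp hwN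
          · exact (congrArg (· ∈ R) (norm_cls E α _)).mp hb2
        · exact (Sum.inl_ne_inr e).elim
    · change W ∈ 𝓝 (incl E α ⟨v, 0⟩) at hW
      rw [← map_incl_nhds E α, mem_map] at hW
      obtain ⟨t, ht, htW⟩ := mem_comap.1 (hA.zero_nhds v hW)
      obtain ⟨N, hN, R, hR, hNR⟩ := mem_nhds_prod_iff.1 ht
      refine mem_comap.2 ⟨(Sum.inr '' N) ×ˢ R,
        prod_mem_nhds (isOpenMap_inr.image_mem_nhds hN) hR, ?_⟩
      rintro b ⟨⟨w, hw, e⟩, hb⟩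
      obtain ⟨x, rfl⟩ | ⟨a, rfl⟩ := exists_rep E α b
      · exact (Sum.inr_ne_inl e).elim
      · obtain rfl : w = a.proj := Sum.inr.inj e
        exact htW (hNR ⟨hw, hb⟩)

theorem hasSeparableSections [LocallyCompactSpace Z] [T2Space Z] [SecondCountableTopology Z]
    (hΓ : Γ.IsLCH) (hΔ : Δ.IsLCH) (hA : IsUSCCStarBundle A) (hS : HasSeparableSections A) :
    HasSeparableSections (LinkBundle E α) := by
  have := hΔ.t2Space_units
  have := hΔ.locallyCompactSpace_units
  have := hΔ.secondCountableTopology_units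
  have := hΓ.locallyCompactSpace_units
  have := hΓ.secondCountableTopology_units
  have : LocallyCompactSpace (G₀ ⊕ H₀) := locallyCompactSpace_sum
  have := hA.secondCountable_of_separable hS
  have := secondCountableTopology E α hΔ
  exact (isUSCCStarBundle E α hΔ hA).separable_of_secondCountable

end LinkBundle

end linkBundle

/-! ### The action of the linking groupoid -/

section linkAction

variable {G : Type uG} {G₀ : Type uG0} {H : Type uH}
  [TopologicalSpace G] [TopologicalSpace G₀] {Γ : Gpd G G₀}
  [TopologicalSpace H] {H₀ : Type u} [TopologicalSpace H₀] {Δ : Gpd H H₀}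
  {Z : Type u} [TopologicalSpace Z]
  {A : H₀ → Type u} [∀ v, NonUnitalCStarAlgebra (A v)] [TopologicalSpace (Tot A)]
  (E : GpdEquivalence Γ Δ Z) (α : BundleAction Δ A)

namespace LinkBundle

theorem cls_congr {z z' : Z} {a a' : Tot A} (ez : z = z') (ea : a = a')
    (h : E.right.anchor z = a.proj) (h' : E.right.anchor z' = a'.proj) :
    cls E α ⟨(z, a), h⟩ = cls E α ⟨(z', a'), h'⟩ := by
  subst ez ea; rfl

theorem cls_smul (z : Z) (η : H) (hη : E.right.anchor z = Δ.r η) (a : Tot A)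
    (ha : a.proj = Δ.s η) :
    cls E α ⟨(z, famAct Δ α.iso η a ha), hη⟩
      = cls E α ⟨(E.right.smul z η hη, a), (E.right.anchor_smul z η hη).trans ha.symm⟩ := by
  rw [← mk_inl_eq_cls E α _ (E.left_anchor_smul z η hη)]
  exact congrArg (Bundle.TotalSpace.mk (Sum.inl (E.left.anchor z)))
    (IndFiber.mk_eq_mk_smul E α z rfl _ hη η hη a ha rfl)

/-- The isomorphisms `β_k` between the fibres of the bundle `B`. -/
def iso : ∀ k : Link G Z H,
    LinkBundle E α (E.linking.s k) ≃⋆ₐ[ℂ] LinkBundle E α (E.linking.r k)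
  | .inl γ =>
    ((fiberIso E α (basePoint E (Γ.s γ)) (anchor_basePoint E (Γ.s γ)) rfl).symm.trans
      (fiberIso E α (E.left.smul γ (basePoint E (Γ.s γ)) (anchor_basePoint E (Γ.s γ)).symm)
        (E.left.anchor_smul _ _ _) (E.right_anchor_smul _ _ _)) :
      IndFiber E α (Γ.s γ) ≃⋆ₐ[ℂ] IndFiber E α (Γ.r γ))
  | .inr (.inl z) =>
    (fiberIso E α z rfl rfl : A (E.right.anchor z) ≃⋆ₐ[ℂ] IndFiber E α (E.left.anchor z))
  | .inr (.inr (.inl z)) =>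
    ((fiberIso E α z.unop rfl rfl).symm :
      IndFiber E α (E.left.anchor z.unop) ≃⋆ₐ[ℂ] A (E.right.anchor z.unop))
  | .inr (.inr (.inr η)) => α.iso η

theorem iso_ofG (γ : G) (z : Z) (h : Γ.s γ = E.left.anchor z) (a : Tot A)
    (ha : E.right.anchor z = a.proj) :
    iso E α (.ofG γ) (IndFiber.mk E α z h.symm a ha)
      = IndFiber.mk E α (E.left.smul γ z h) (E.left.anchor_smul γ z h) a
          ((E.right_anchor_smul γ z h).trans ha) := by
  -- At the base point used to define the isomorphism the formula holds by construction.
  have key : ∀ (b : Tot A) (hb : E.right.anchor (basePoint E (Γ.s γ)) = b.proj),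
      iso E α (.ofG γ)
        (IndFiber.mk E α (basePoint E (Γ.s γ)) (anchor_basePoint E (Γ.s γ)) b hb)
      = IndFiber.mk E α
          (E.left.smul γ (basePoint E (Γ.s γ)) (anchor_basePoint E (Γ.s γ)).symm)
          (E.left.anchor_smul _ _ _) b ((E.right_anchor_smul _ _ _).trans hb) := by
    rintro ⟨v, b⟩ hb
    change E.right.anchor _ = v at hb
    subst hb
    rw [← fiberIso_apply, ← fiberIso_apply]
    exact congrArg (fiberIso E α (E.left.smul γ (basePoint E (Γ.s γ))
      (anchor_basePoint E (Γ.s γ)).symm) (E.left.anchor_smul _ _ _) (E.right_anchor_smul _ _ _))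
      ((fiberIso E α _ (anchor_basePoint E (Γ.s γ)) rfl).symm_apply_apply b)
  have hz := anchor_basePoint E (Γ.s γ)
  -- A general `z` is `z₀ · η` with `z₀` the base point: `[z₀ · η, a] = [z₀, α_η(a)]` goes to `[γ ·
  -- z₀, α_η(a)] = [(γ · z₀) · η, a]`, and the two actions commute.
  obtain ⟨η, hη, rfl⟩ := E.exists_right (basePoint E (Γ.s γ)) z (hz.trans h)
  have hs : a.proj = Δ.s η := ha.symm.trans (E.right.anchor_smul _ _ hη)
  refine (congrArg (iso E α (.ofG γ)) (IndFiber.mk_eq_mk_smul E α (basePoint E (Γ.s γ)) hz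
    (famAct Δ α.iso η a hs) hη η hη a hs rfl).symm).trans ((key _ hη).trans ?_)
  refine (IndFiber.mk_eq_mk_smul E α _ (E.left.anchor_smul γ _ hz.symm) _
    ((E.right_anchor_smul _ _ _).trans hη) η ((E.right_anchor_smul _ _ _).trans hη) a hs rfl).trans
    ?_
  exact IndFiber.mk_congr E α (E.smul_comm _ _ _ hz.symm hη) rfl _ _ _ _

theorem iso_ofZop (z : Z) (a : A (E.right.anchor z)) :
    iso E α (.ofZop z) (IndFiber.mk E α z rfl ⟨E.right.anchor z, a⟩ rfl) = a := by
  rw [← fiberIso_apply]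
  exact (fiberIso E α z rfl rfl).symm_apply_apply a

theorem toFiber_cls {u : G₀} (x : Pullback E A) (hu : E.left.anchor x.1.1 = u)
    (h : (cls E α x).proj = .inl u) :
    toFiber (cls E α x) h = IndFiber.mk E α x.1.1 hu x.1.2 x.2 := by
  subst hu; rfl

theorem famAct_congr_arg {k : Link G Z H} {b b' : Tot (LinkBundle E α)} (e : b = b')
    (h : b.proj = E.linking.s k) (h' : b'.proj = E.linking.s k) :
    famAct E.linking (iso E α) k b h = famAct E.linking (iso E α) k b' h' := by
  subst e; rfl

theorem famAct_ofG (γ : G) (x : Pullback E A) (h : Γ.s γ = E.left.anchor x.1.1)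
    (h' : (cls E α x).proj = E.linking.s (.ofG γ)) :
    famAct E.linking (iso E α) (.ofG γ) (cls E α x) h' =
      cls E α ⟨(E.left.smul γ x.1.1 h, x.1.2), (E.right_anchor_smul _ _ _).trans x.2⟩ := by
  rw [← mk_inl_eq_cls E α _ (E.left.anchor_smul γ x.1.1 h)]
  refine congrArg (Bundle.TotalSpace.mk (Sum.inl (Γ.r γ))) ?_
  exact (congrArg (iso E α (.ofG γ)) (toFiber_cls E α x h.symm h')).trans
    (iso_ofG E α γ x.1.1 h x.1.2 x.2)

theorem famAct_ofZ (z : Z) (a : Tot A) (h : E.right.anchor z = a.proj)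
    (h' : (incl E α a).proj = E.linking.s (.ofZ z)) :
    famAct E.linking (iso E α) (.ofZ z) (incl E α a) h' = cls E α ⟨(z, a), h⟩ := by
  obtain ⟨v, a⟩ := a
  change E.right.anchor z = v at h
  subst h
  exact congrArg (Bundle.TotalSpace.mk (Sum.inl (E.left.anchor z)))
    (fiberIso_apply E α z rfl rfl a)

theorem famAct_ofZop (z : Z) (x : Pullback E A) (h : E.left.anchor z = E.left.anchor x.1.1)
    (h' : (cls E α x).proj = E.linking.s (.ofZop z)) :
    famAct E.linking (iso E α) (.ofZop z) (cls E α x) h' =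
      incl E α (famAct Δ α.iso (E.rbr z x.1.1 h) x.1.2
        (x.2.symm.trans (E.s_rbr _ _ _).symm)) := by
  have key : ∀ (a : Tot A) (ha : E.right.anchor z = a.proj)
      (h₀ : (cls E α ⟨(z, a), ha⟩).proj = E.linking.s (.ofZop z)),
      famAct E.linking (iso E α) (.ofZop z) (cls E α ⟨(z, a), ha⟩) h₀ = incl E α a := by
    rintro ⟨v, a⟩ ha h₀
    change E.right.anchor z = v at ha
    subst ha
    exact congrArg (Bundle.TotalSpace.mk (Sum.inr (E.right.anchor z))) (iso_ofZop E α z a)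
  exact (famAct_congr_arg E α (cls_rbr E α z x h) _ rfl).trans (key _ (E.r_rbr _ _ _) rfl)

theorem famAct_ofH (η : H) (a : Tot A) (h : a.proj = Δ.s η)
    (h' : (incl E α a).proj = E.linking.s (.ofH η)) :
    famAct E.linking (iso E α) (.ofH η) (incl E α a) h' = incl E α (famAct Δ α.iso η a h) := by
  obtain ⟨v, a⟩ := a
  obtain rfl : v = Δ.s η := h
  rfl

/-- Eight blocks remain after excluding non-composable ones. On a class `[x, a]` both sides are
evaluated by the formulas for `β`, and the arrows or points obtained agree because `(kl)x = k(lx)`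
in `L`; on a vector of `A` the formulas match directly. -/
theorem famAct_mul (k l : Link G Z H) (h : E.linking.s k = E.linking.r l)
    (b : Tot (LinkBundle E α)) (hb : b.proj = E.linking.s l) :
    famAct E.linking (iso E α) (E.linking.mul k l h) b
        (hb.trans (E.linking.s_mul k l h).symm)
      = famAct E.linking (iso E α) k (famAct E.linking (iso E α) l b hb) h.symm := by
  obtain ⟨x, rfl⟩ | ⟨a, rfl⟩ := exists_rep E α b <;>
  rcases l with γ' | w | w | η' <;>
    first
    | exact (Sum.inl_ne_inr hb).elim
    | exact (Sum.inr_ne_inl hb).elim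
    | skip
  all_goals
    rcases k with γ | z | z | η <;>
    first
    | exact (Sum.inl_ne_inr h).elim
    | exact (Sum.inr_ne_inl h).elim
    | skip
  · have h1 : Γ.s γ = Γ.r γ' := Sum.inl.inj h
    have h2 : Γ.s γ' = E.left.anchor x.1.1 := (Sum.inl.inj hb).symm
    have h3 := h1.trans (E.left.anchor_smul γ' x.1.1 h2).symm
    refine (famAct_ofG E α (Γ.mul γ γ' h1) x ((Γ.s_mul _ _ _).trans h2) _).trans ?_
    refine Eq.trans ?_ (famAct_congr_arg E α (k := .ofG γ)
      (famAct_ofG E α γ' x h2 hb).symm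
      (congrArg Sum.inl h3.symm) _)
    refine Eq.trans ?_ (famAct_ofG E α γ _ h3 _).symm
    exact cls_congr E α (E.left.mul_smul _ _ _ h1 h2) rfl _ _
  · have h1 : E.left.anchor z.unop = Γ.r γ' := Sum.inl.inj h
    have h2 : Γ.s γ' = E.left.anchor x.1.1 := (Sum.inl.inj hb).symm
    have h3 := h1.trans (E.left.anchor_smul γ' x.1.1 h2).symm
    have h4 : Γ.s (Γ.inv γ') = E.left.anchor z.unop := (Γ.s_inv _).trans h1.symm
    have h5 : E.left.anchor (E.left.smul (Γ.inv γ') z.unop h4) = E.left.anchor x.1.1 :=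
      (E.left.anchor_smul _ _ _).trans ((Γ.r_inv _).trans h2)
    refine (famAct_ofZop E α (E.left.smul (Γ.inv γ') z.unop h4) x h5 _).trans ?_
    refine Eq.trans ?_ (famAct_congr_arg E α (k := .ofZop z.unop)
      (famAct_ofG E α γ' x h2 hb).symm
      (congrArg Sum.inl h3.symm) _)
    refine Eq.trans ?_ (famAct_ofZop E α z.unop _ h3 _).symm
    refine congrArg (incl E α) (α.famAct_congr ?_ rfl _ _)
    -- Read in the component `H`, associativity says `[γ'⁻¹ · z, x]_H = [z, γ' · x]_H`.
    have := E.linkMul_assoc (.ofZop z.unop) (.ofG γ') (.ofZ x.1.1) h (congrArg Sum.inl h2)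
      (congrArg Sum.inl h5) (congrArg Sum.inl h3)
    exact Sum.inr.inj (Sum.inr.inj (Sum.inr.inj this))
  · have h1 : E.right.anchor z = E.right.anchor w.unop := Sum.inr.inj h
    have h2 : E.left.anchor w.unop = E.left.anchor x.1.1 := (Sum.inl.inj hb).symm
    have h3 : Γ.s (E.lbr z w.unop h1) = E.left.anchor x.1.1 := (E.s_lbr _ _ _).trans h2
    have h4 : E.right.anchor z = Δ.r (E.rbr w.unop x.1.1 h2) := h1.trans (E.r_rbr _ _ _)
    refine (famAct_ofG E α (E.lbr z w.unop h1) x h3 _).trans ?_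
    refine Eq.trans ?_ (famAct_congr_arg E α (k := .ofZ z)
      (famAct_ofZop E α w.unop x h2 hb).symm
      (congrArg Sum.inr h4.symm) _)
    refine Eq.trans ?_ (famAct_ofZ E α z _ h4 _).symm
    refine Eq.trans ?_ (cls_smul E α z _ h4 x.1.2 _).symm
    refine cls_congr E α ?_ rfl _ _
    have := E.linkMul_assoc (.ofZ z) (.ofZop w.unop) (.ofZ x.1.1) h (congrArg Sum.inl h2)
      (congrArg Sum.inl h3) (congrArg Sum.inr h4)
    exact Sum.inl.inj (Sum.inr.inj this)
  · have h1 : Δ.s η = E.right.anchor w.unop := Sum.inr.inj h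
    have h2 : E.left.anchor w.unop = E.left.anchor x.1.1 := (Sum.inl.inj hb).symm
    have h3 : E.right.anchor w.unop = Δ.r (Δ.inv η) := h1.symm.trans (Δ.r_inv _).symm
    have h4 : E.left.anchor (E.right.smul w.unop (Δ.inv η) h3) = E.left.anchor x.1.1 :=
      (E.left_anchor_smul _ _ _).trans h2
    have h5 : Δ.s η = Δ.r (E.rbr w.unop x.1.1 h2) := h1.trans (E.r_rbr _ _ _)
    refine (famAct_ofZop E α (E.right.smul w.unop (Δ.inv η) h3) x h4 _).trans ?_
    refine Eq.trans ?_ (famAct_congr_arg E α (k := .ofH η)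
      (famAct_ofZop E α w.unop x h2 hb).symm
      (congrArg Sum.inr h5.symm) _)
    refine Eq.trans ?_ (famAct_ofH E α η _ h5.symm _).symm
    refine congrArg (incl E α) ?_
    refine Eq.trans ?_ (α.mul_act η _ h5 x.1.2 (x.2.symm.trans (E.s_rbr _ _ h2).symm))
    refine α.famAct_congr ?_ rfl _ _
    have := E.linkMul_assoc (.ofH η) (.ofZop w.unop) (.ofZ x.1.1) h (congrArg Sum.inl h2)
      (congrArg Sum.inl h4) (congrArg Sum.inr h5)
    exact Sum.inr.inj (Sum.inr.inj (Sum.inr.inj this))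
  · have h1 : Γ.s γ = E.left.anchor w := Sum.inl.inj h
    have h2 : E.right.anchor w = a.proj := (Sum.inr.inj hb).symm
    refine (famAct_ofZ E α (E.left.smul γ w h1) a ((E.right_anchor_smul _ _ _).trans h2) _).trans ?_
    refine Eq.trans ?_ (famAct_congr_arg E α (k := .ofG γ)
      (famAct_ofZ E α w a h2 hb).symm
      (congrArg Sum.inl h1.symm) _)
    exact (famAct_ofG E α γ ⟨(w, a), h2⟩ h1 _).symm
  · have h1 : E.left.anchor z.unop = E.left.anchor w := Sum.inl.inj h
    have h2 : E.right.anchor w = a.proj := (Sum.inr.inj hb).symm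
    refine (famAct_ofH E α (E.rbr z.unop w h1) a (h2.symm.trans (E.s_rbr _ _ _).symm) _).trans ?_
    refine Eq.trans ?_ (famAct_congr_arg E α (k := .ofZop z.unop)
      (famAct_ofZ E α w a h2 hb).symm
      (congrArg Sum.inl h1.symm) _)
    exact (famAct_ofZop E α z.unop ⟨(w, a), h2⟩ h1 _).symm
  · have h1 : E.right.anchor z = Δ.r η' := Sum.inr.inj h
    have h2 : a.proj = Δ.s η' := Sum.inr.inj hb
    refine (famAct_ofZ E α (E.right.smul z η' h1) a
      ((E.right.anchor_smul _ _ _).trans h2.symm) _).trans ?_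
    refine Eq.trans ?_ (famAct_congr_arg E α (k := .ofZ z)
      (famAct_ofH E α η' a h2 hb).symm
      (congrArg Sum.inr h1.symm) _)
    refine Eq.trans ?_ (famAct_ofZ E α z _ h1 _).symm
    exact (cls_smul E α z η' h1 a h2).symm
  · have h1 : Δ.s η = Δ.r η' := Sum.inr.inj h
    have h2 : a.proj = Δ.s η' := Sum.inr.inj hb
    refine (famAct_ofH E α (Δ.mul η η' h1) a (h2.trans (Δ.s_mul _ _ _).symm) _).trans ?_
    refine Eq.trans ?_ (famAct_congr_arg E α (k := .ofH η)
      (famAct_ofH E α η' a h2 hb).symm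
      (congrArg Sum.inr h1.symm) _)
    refine Eq.trans ?_ (famAct_ofH E α η _ h1.symm _).symm
    exact congrArg (incl E α) (α.mul_act η η' h1 a h2)

theorem continuousAt_famAct {X Y W : Type*} [TopologicalSpace X] [TopologicalSpace Y]
    [TopologicalSpace W] {i : X → Link G Z H}
    {j : Y → Tot (LinkBundle E α)} {k : W → Tot (LinkBundle E α)} (hi : IsOpenEmbedding i)
    (hj : IsOpenMap j) (hjc : Continuous j) (hk : Continuous k)
    {F : {p : X × Y // (j p.2).proj = E.linking.s (i p.1)} → W} (hF : Continuous F)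
    (e : ∀ p, k (F p) = famAct E.linking (iso E α) (i p.1.1) (j p.1.2) p.2) (x : X) (y : Y)
    (h : (j y).proj = E.linking.s (i x)) :
    ContinuousAt (fun p : {p : Link G Z H × Tot (LinkBundle E α) //
      p.2.proj = E.linking.s p.1} => famAct E.linking (iso E α) p.1.1 p.1.2 p.2)
      ⟨(i x, j y), h⟩ := by
  refine continuousAt_subtype_of_comp (κ := Prod.map i j)
    (P := fun p => p.2.proj = E.linking.s p.1) (hi.isOpenMap.prodMap hj)
    (hi.continuous.prodMap hjc)
    (F := fun p => famAct E.linking (iso E α) p.1.1 p.1.2 p.2) ?_ (x, y) h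
  exact (hk.comp hF).congr e

theorem continuous_famAct (hΔ : Δ.IsLCH) :
    Continuous fun p : {p : Link G Z H × Tot (LinkBundle E α) // p.2.proj = E.linking.s p.1} =>
      famAct E.linking (iso E α) p.1.1 p.1.2 p.2 := by
  have hcls := continuous_cls E α
  have hincl := (isOpenEmbedding_incl E α).continuous
  have hval : Continuous fun x : Pullback E A => (x.1 : Z × Tot A) := continuous_subtype_val
  refine continuous_iff_continuousAt.2 ?_
  rintro ⟨⟨k, b⟩, h⟩
  obtain ⟨x, rfl⟩ | ⟨a, rfl⟩ := exists_rep E α b <;>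
  rcases k with γ | z | z | η <;>
    first
    | exact (Sum.inl_ne_inr h).elim
    | exact (Sum.inr_ne_inl h).elim
    | skip
  · let D := {p : G × Pullback E A //
      (cls E α p.2).proj = E.linking.s (Link.ofG p.1 : Link G Z H)}
    have h1 : ∀ p : D, Γ.s p.1.1 = E.left.anchor p.1.2.1.1 := fun p => (Sum.inl.inj p.2).symm
    have h2 : Continuous fun p : D => E.left.smul p.1.1 p.1.2.1.1 (h1 p) :=
      E.left.continuous_smul.comp (Continuous.subtype_mk
        (f := fun p : D => (p.1.1, p.1.2.1.1)) (by fun_prop) h1)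
    have h3 : Continuous fun p : D => p.1.2.1.2 := by fun_prop
    have h4 : Continuous fun p : D => (⟨(E.left.smul p.1.1 p.1.2.1.1 (h1 p), p.1.2.1.2),
        (E.right_anchor_smul _ _ (h1 p)).trans p.1.2.2⟩ : Pullback E A) :=
      (h2.prodMk h3).subtype_mk _
    exact continuousAt_famAct E α Link.isOpenEmbedding_ofG (isOpenMap_cls E α hΔ) hcls hcls h4
      (fun p => (famAct_ofG E α p.1.1 p.1.2 (h1 p) p.2).symm) γ x h
  · let D := {p : Z × Pullback E A //
      (cls E α p.2).proj = E.linking.s (Link.ofZop p.1 : Link G Z H)}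
    have h1 : ∀ p : D, E.left.anchor p.1.1 = E.left.anchor p.1.2.1.1 :=
      fun p => (Sum.inl.inj p.2).symm
    have h2 : Continuous fun p : D => E.rbr p.1.1 p.1.2.1.1 (h1 p) :=
      E.continuous_rbr.comp (Continuous.subtype_mk
        (f := fun p : D => (p.1.1, p.1.2.1.1)) (by fun_prop) h1)
    have h3 : Continuous fun p : D => famAct Δ α.iso (E.rbr p.1.1 p.1.2.1.1 (h1 p)) p.1.2.1.2
        (p.1.2.2.symm.trans (E.s_rbr _ _ _).symm) :=
      α.continuous_act.comp (Continuous.subtype_mk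
        (f := fun p : D => (E.rbr p.1.1 p.1.2.1.1 (h1 p), p.1.2.1.2)) (by fun_prop)
        fun p => p.1.2.2.symm.trans (E.s_rbr _ _ (h1 p)).symm)
    exact continuousAt_famAct E α Link.isOpenEmbedding_ofZop (isOpenMap_cls E α hΔ) hcls hincl h3
      (fun p => (famAct_ofZop E α p.1.1 p.1.2 (h1 p) p.2).symm) z.unop x h
  · let D := {p : Z × Tot A // (incl E α p.2).proj = E.linking.s (Link.ofZ p.1 : Link G Z H)}
    have h1 : ∀ p : D, E.right.anchor p.1.1 = p.1.2.proj := fun p => (Sum.inr.inj p.2).symm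
    exact continuousAt_famAct E α Link.isOpenEmbedding_ofZ (isOpenEmbedding_incl E α).isOpenMap
      hincl hcls (continuous_subtype_val.subtype_mk h1)
      (fun p => (famAct_ofZ E α p.1.1 p.1.2 (h1 p) p.2).symm) z a h
  · let D := {p : H × Tot A // (incl E α p.2).proj = E.linking.s (Link.ofH p.1 : Link G Z H)}
    have h1 : ∀ p : D, p.1.2.proj = Δ.s p.1.1 := fun p => Sum.inr.inj p.2
    exact continuousAt_famAct E α Link.isOpenEmbedding_ofH (isOpenEmbedding_incl E α).isOpenMap
      hincl hincl (α.continuous_act.comp (continuous_subtype_val.subtype_mk h1))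
      (fun p => (famAct_ofH E α p.1.1 p.1.2 (h1 p) p.2).symm) η a h

/-- The action of the linking groupoid on the bundle `B`. -/
def action (hΔ : Δ.IsLCH) : BundleAction E.linking (LinkBundle E α) where
  iso := iso E α
  mul_act := famAct_mul E α
  continuous_act := continuous_famAct E α hΔ

end LinkBundle

end linkAction

end GpdDyn

end

theorem mainTheorem5
    {G : Type*} {G₀ : Type*} {H : Type*} {H₀ Z : Type u}
    [TopologicalSpace G] [TopologicalSpace G₀] [TopologicalSpace H] [TopologicalSpace H₀]
    [TopologicalSpace Z] [LocallyCompactSpace Z] [T2Space Z] [SecondCountableTopology Z]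
    (Γ : GpdDyn.Gpd G G₀) (hΓ : Γ.IsLCH) (Δ : GpdDyn.Gpd H H₀) (hΔ : Δ.IsLCH)
    (E : GpdDyn.GpdEquivalence Γ Δ Z)
    (A : H₀ → Type u) [∀ v, NonUnitalCStarAlgebra (A v)] [TopologicalSpace (GpdDyn.Tot A)]
    (hA : GpdDyn.IsUSCCStarBundle A) (α : GpdDyn.BundleAction Δ A) :
    -- `L` is a second countable locally compact Hausdorff groupoid, `B` is a bundle over its units
    E.linking.IsLCH ∧
    GpdDyn.IsUSCCStarBundle (GpdDyn.LinkBundle E α) ∧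
    -- separability passes from `A` to `B`
    (GpdDyn.HasSeparableSections A → GpdDyn.HasSeparableSections (GpdDyn.LinkBundle E α)) ∧
    -- the restriction of `B` to `H₀` is the bundle `A`
    Topology.IsOpenEmbedding
      (fun a : GpdDyn.Tot A => (⟨.inr a.proj, a.2⟩ : GpdDyn.Tot (GpdDyn.LinkBundle E α))) ∧
    ∃ β : GpdDyn.BundleAction E.linking (GpdDyn.LinkBundle E α),
      -- on `G`: `[z, a] ↦ [γ • z, a]`
      (∀ (γ : G) (z : Z) (h : Γ.s γ = E.left.anchor z) (a : GpdDyn.Tot A)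
          (ha : E.right.anchor z = a.proj),
        β.iso (.ofG γ) (GpdDyn.IndFiber.mk E α z h.symm a ha)
          = GpdDyn.IndFiber.mk E α (E.left.smul γ z h) (E.left.anchor_smul γ z h) a
              ((E.right_anchor_smul γ z h).trans ha)) ∧
      -- on `H`: `α`
      (∀ (η : H) (a : A (Δ.s η)), β.iso (.ofH η) a = α.iso η a) ∧
      -- on `Z`: `a ↦ [z, a]`
      (∀ (z : Z) (a : A (E.right.anchor z)),
        β.iso (.ofZ z) a = GpdDyn.IndFiber.mk E α z rfl ⟨E.right.anchor z, a⟩ rfl) ∧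
      -- on the opposite space: `[z, a] ↦ a`
      (∀ (z : Z) (a : A (E.right.anchor z)),
        β.iso (.ofZop z) (GpdDyn.IndFiber.mk E α z rfl ⟨E.right.anchor z, a⟩ rfl) = a) := by
  refine ⟨E.linking_isLCH hΓ hΔ, GpdDyn.LinkBundle.isUSCCStarBundle E α hΔ hA,
    GpdDyn.LinkBundle.hasSeparableSections E α hΓ hΔ hA,
    GpdDyn.LinkBundle.isOpenEmbedding_incl E α, GpdDyn.LinkBundle.action E α hΔ,
    GpdDyn.LinkBundle.iso_ofG E α, fun _ _ => rfl, fun z a => ?_, GpdDyn.LinkBundle.iso_ofZop E α⟩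
  exact GpdDyn.fiberIso_apply E α z rfl rfl a
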